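/- Let $m,r\ge 1$, let $P(\lambda)=\sum_{j=0}^m\lambda^jA_j$ with $A_j\in\mathbb C^{n\times n}$ and $\operatorname{rank}(A_m)=n$, and let $\mathbb S=\{\lambda_1,\dots,\lambda_s\}$ be a finite set of complex numbers. Define $$\tau_r(\mathbb S):=\inf\Big\{\|\Delta\|_2 \;:\; \Delta\in\mathbb C^{n\times n},\ \sum_{j=1}^s m_j(P+\Delta)\ge r\Big\}\in[0,\infty],$$ where $m_j(P+\Delta)$ is the multiplicity of $\lambda_j$ as a root of $\det(P(\lambda)+\Delta)$ and $\|\cdot\|_2$ is the spectral norm. For $\mu\in\mathbb C^r$ and $\Gamma=(\gamma_{i\ell})_{1\le \ell<i\le r}\in\mathbb C^{r(r-1)/2}$ let $C(\mu,\Gamma)\in\mathbb C^{r\times r}$ be the upper triangular matrix with diagonal $\mu_1,\dots,\mu_r$ and entry $\gamma_{i\ell}$ in row $\ell$ and column $i$ for $\ell<i$, and put $$\mathcal Q(\mu,\Gamma,P):=\sum_{j=0}^m\big(C(\mu,\Gamma)^j\big)^T\otimes A_j\in\mathbb C^{nr\times nr}.$$ Let $P[x_0,\dots,x_k]$ be the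 (entrywise) divided difference of $P$: $P[x_0]=P(x_0)$; if equal nodes are adjacent, it is $\frac{P[x_1,\dots,x_k]-P[x_0,\dots,x_{k-1}]}{x_k-x_0}$ when $x_0\ne x_k$ and $P^{(k)}(x_0)/k!$ when $x_0=x_k$; for other orderings of the nodes it is extended by the same recursion applied to two distinct nodes (so that it is symmetric in the nodes). Let $\sigma_{-k}(M)$ denote the $k$-th smallest singular value of $M$, counted with multiplicity. (1) For all $\mu\in\mathbb C^r$ and all $\Gamma$, the matrix $\mathcal Q(\mu,\Gamma,P)$ is block lower triangular, and its $n\times n$ block in block row $i$ and block column $\ell$ is $$\begin{cases}\displaystyle\sum_{(s_0,\dots,s_k)}\gamma_{s_1s_0}\gamma_{s_2s_1}\cdots\gamma_{s_ks_{k-1}}\,P[\mu_{s_0},\dots,\mu_{s_k}] & i>\ell,\\ P(\mu_i)& i=\ell,\\ 0& i<\ell,\end{cases}$$ where the sum is over all increasing sequences of integers with $s_0=\ell$ and $s_k=i$. (2) Suppose that $\mu\in\mathbb S^r$ attains the minimum over $\mathbb S^r$ of $\kappa_r(\nu):=\sup_{\Gamma}\sigma_{-r}(\mathcal Q(\nu,\Gamma,P))$;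 that, if $r>n$ or if $P[\mu_k,\mu_\ell]$ is singular for some $k<\ell$, the supremum $\kappa_r(\mu)$ is attained; and that, if this supremum is attained, it is attained at some $\Gamma_*$ satisfying * (multiplicity assumption) the singular value $\sigma_{-r}(\mathcal Q(\mu,\Gamma_*,P))$ has multiplicity one; * (linear independence assumption) there are matrices $\mathcal U,\mathcal V\in\mathbb C^{n\times r}$ such that $\operatorname{vec}(\mathcal U),\operatorname{vec}(\mathcal V)$ is a consistent pair of unit left and right singular vectors for this singular value and $\operatorname{rank}(\mathcal V)=r$. (Consistent means $\mathcal Q\operatorname{vec}(\mathcal V)=\sigma\operatorname{vec}(\mathcal U)$ and $\operatorname{vec}(\mathcal U)^*\mathcal Q=\sigma\operatorname{vec}(\mathcal V)^*$, with $\mathcal Q=\mathcal Q(\mu,\Gamma_*,P)$ and $\sigma=\sigma_{-r}(\mathcal Q)$; $\operatorname{vec}$ stacks the columns.) Then $$\tau_r(\mathbb S)=\inf_{\nu\in\mathbb S^r}\ \sup_{\Gamma\in\mathbb C^{r(r-1)/2}}\ \sigma_{-r}\big(\mathcal Q(\nu,\Gamma,P)\big).$$ -/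

import Mathlib

open scoped ENNReal Matrix Kronecker Polynomial

noncomputable section

namespace MatPoly

/-! ### Singular values -/

/-- The singular values `σ 0 ≥ σ 1 ≥ …` of a square complex matrix, with multiplicity. -/
def sv {ι : Type*} [Fintype ι] [DecidableEq ι] (M : Matrix ι ι ℂ) (i : ℕ) : ℝ :=
  (Matrix.toEuclideanLin M).singularValues i

/-- `σ₋ₖ(M)`: the `k`-th smallest singular value of a square matrix (`1 ≤ k ≤ card ι`). -/
def svSmallest {ι : Type*} [Fintype ι] [DecidableEq ι] (k : ℕ) (M : Matrix ι ι ℂ) : ℝ :=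
  sv M (Fintype.card ι - k)

/-- The multiplicity of `x` among the `card ι` singular values of `M`. -/
def svMultiplicity {ι : Type*} [Fintype ι] [DecidableEq ι] (M : Matrix ι ι ℂ) (x : ℝ) : ℕ :=
  Set.ncard {i : ℕ | i < Fintype.card ι ∧ sv M i = x}

/-- The spectral norm `‖Δ‖₂`. -/
def specNorm {n : ℕ} (Δ : Matrix (Fin n) (Fin n) ℂ) : ℝ :=
  ‖Matrix.toEuclideanCLM (𝕜 := ℂ) Δ‖

/-! ### Divided differences -/

/-- The divided difference `f[x₀, …, xₖ]`.  The first and the last case are the usual recursion for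
nodes in which equal nodes are adjacent (then `x₀ = xₖ` forces all nodes to be equal, and the middle
case never occurs).  The middle case extends it to arbitrarily ordered nodes: when `x₀ = xₖ` but
some `xᵢ ≠ x₀`, the same recursion is applied to the pair of distinct nodes `x₀`, `xᵢ`, that is
`f[x₀, …, xₖ] = (f[all but x₀] - f[all but xᵢ]) / (xᵢ - x₀)`. -/
def dividedDiff (f : ℂ → ℂ) : (k : ℕ) → (Fin (k + 1) → ℂ) → ℂ
  | 0, x => f (x 0)
  | k + 1, x =>
    open Classical in
    if x 0 ≠ x (Fin.last (k + 1)) then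
      (dividedDiff f k (fun t => x t.succ) - dividedDiff f k (fun t => x t.castSucc)) /
        (x (Fin.last (k + 1)) - x 0)
    else if h : ∃ i, x i ≠ x 0 then
      (dividedDiff f k (fun t => x t.succ) - dividedDiff f k (fun t => x (h.choose.succAbove t))) /
        (x h.choose - x 0)
    else
      iteratedDeriv (k + 1) f (x 0) / ((k + 1).factorial : ℂ)

/-! ### Matrix polynomials -/

variable {n m r : ℕ}

/-- The value `P(z) = ∑ⱼ zʲ Aⱼ`. -/
def value (A : Fin (m + 1) → Matrix (Fin n) (Fin n) ℂ) (z : ℂ) : Matrix (Fin n) (Fin n) ℂ :=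
  ∑ j : Fin (m + 1), z ^ (j : ℕ) • A j

/-- The matrix divided difference `P[x₀, …, xₖ]`, taken entrywise. -/
def matDividedDiff (A : Fin (m + 1) → Matrix (Fin n) (Fin n) ℂ) {k : ℕ} (x : Fin (k + 1) → ℂ) :
    Matrix (Fin n) (Fin n) ℂ :=
  Matrix.of fun a b => dividedDiff (fun z => value A z a b) k x

/-- The polynomial `det (P(λ) + Δ)` in `λ`. -/
def pertDet (A : Fin (m + 1) → Matrix (Fin n) (Fin n) ℂ) (Δ : Matrix (Fin n) (Fin n) ℂ) : ℂ[X] :=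
  ((∑ j : Fin (m + 1), (Polynomial.X : ℂ[X]) ^ (j : ℕ) • (A j).map Polynomial.C) +
    Δ.map Polynomial.C).det

/-- `τᵣ(S)`: the infimum of `‖Δ‖₂` over all `Δ` for which the algebraic multiplicities of the
elements of `S` as eigenvalues of `P + Δ` add up to at least `r` (`∞` if there is no such `Δ`). -/
def tau (A : Fin (m + 1) → Matrix (Fin n) (Fin n) ℂ) (S : Finset ℂ) (r : ℕ) : ℝ≥0∞ :=
  ⨅ Δ ∈ {Δ : Matrix (Fin n) (Fin n) ℂ | r ≤ ∑ z ∈ S, (pertDet A Δ).rootMultiplicity z},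
    ENNReal.ofReal (specNorm Δ)

/-- The parameter space `ℂ^{r(r-1)/2}`: a family `γ_{il}` indexed by the pairs `(i, l)`, `l < i`. -/
abbrev Params (r : ℕ) : Type := {p : Fin r × Fin r // p.2 < p.1} → ℂ

/-- The entry `γ_{il}` for `l < i` (and `0` otherwise). -/
def gam (Γ : Params r) (i l : Fin r) : ℂ :=
  if h : l < i then Γ ⟨(i, l), h⟩ else 0

/-- The upper triangular matrix `C(μ, Γ)` with diagonal `μ` and entry `γ_{il}` at row `l`,
column `i`, for `l < i`. -/
def triC (μ : Fin r → ℂ) (Γ : Params r) : Matrix (Fin r) (Fin r) ℂ :=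
  Matrix.of fun l i => if l = i then μ i else gam Γ i l

/-- `∑ⱼ (C(μ, Γ)ʲ)ᵀ ⊗ Aⱼ`; the index `(i, a)` is entry `a` of block `i`. -/
def kronQ (A : Fin (m + 1) → Matrix (Fin n) (Fin n) ℂ) (μ : Fin r → ℂ) (Γ : Params r) :
    Matrix (Fin r × Fin n) (Fin r × Fin n) ℂ :=
  ∑ j : Fin (m + 1), (triC μ Γ ^ (j : ℕ))ᵀ ⊗ₖ A j

/-- The sum of `γ_{s₁s₀} ⋯ γ_{sₖsₖ₋₁} P[μ_{s₀}, …, μ_{sₖ}]` over all increasing sequences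
`(s₀, …, sₖ)` of indices with `s₀ = l` and `sₖ = i`. -/
def chainSum (A : Fin (m + 1) → Matrix (Fin n) (Fin n) ℂ) (μ : Fin r → ℂ) (Γ : Params r)
    (i l : Fin r) : Matrix (Fin n) (Fin n) ℂ :=
  open Classical in
  ∑ k ∈ Finset.range r,
    ∑ s : Fin (k + 1) → Fin r with StrictMono s ∧ s 0 = l ∧ s (Fin.last k) = i,
      (∏ t : Fin k, gam Γ (s t.succ) (s t.castSucc)) • matDividedDiff A (fun t => μ (s t))

/-- The block lower triangular matrix `Q(μ, Γ, P)` given by divided differences. -/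
def blockQ (A : Fin (m + 1) → Matrix (Fin n) (Fin n) ℂ) (μ : Fin r → ℂ) (Γ : Params r) :
    Matrix (Fin r × Fin n) (Fin r × Fin n) ℂ :=
  Matrix.of fun p q =>
    if q.1 < p.1 then chainSum A μ Γ p.1 q.1 p.2 q.2
    else if p.1 = q.1 then value A (μ p.1) p.2 q.2
    else 0

/-! ### The optimization problem and the two assumptions -/

/-- The objective `σ₋ᵣ(Q(μ, Γ, P))`. -/
def objective (A : Fin (m + 1) → Matrix (Fin n) (Fin n) ℂ) (μ : Fin r → ℂ) (Γ : Params r) : ℝ :=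
  svSmallest r (blockQ A μ Γ)

/-- The inner supremum `sup_Γ σ₋ᵣ(Q(μ, Γ, P))` in `[0, ∞]`. -/
def innerSup (A : Fin (m + 1) → Matrix (Fin n) (Fin n) ℂ) (μ : Fin r → ℂ) : ℝ≥0∞ :=
  ⨆ Γ : Params r, ENNReal.ofReal (objective A μ Γ)

/-- `S^r`. -/
def tuples (S : Finset ℂ) (r : ℕ) : Set (Fin r → ℂ) := {μ | ∀ i, μ i ∈ S}

/-- `μ ∈ S^r` attains the outer infimum. -/
def IsOptimalNodes (A : Fin (m + 1) → Matrix (Fin n) (Fin n) ℂ) (S : Finset ℂ)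
    (μ : Fin r → ℂ) : Prop :=
  μ ∈ tuples S r ∧ ∀ ν ∈ tuples S r, innerSup A μ ≤ innerSup A ν

/-- `Γ` attains the inner supremum at `μ`. -/
def IsOptimalParams (A : Fin (m + 1) → Matrix (Fin n) (Fin n) ℂ) (μ : Fin r → ℂ)
    (Γ : Params r) : Prop :=
  ∀ Γ' : Params r, objective A μ Γ' ≤ objective A μ Γ

/-- Multiplicity assumption: the singular value `σ₋ᵣ(Q(μ, Γ, P))` has multiplicity one. -/
def MultiplicityAssumption (A : Fin (m + 1) → Matrix (Fin n) (Fin n) ℂ) (μ : Fin r → ℂ)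
    (Γ : Params r) : Prop :=
  svMultiplicity (blockQ A μ Γ) (objective A μ Γ) = 1

/-- Linear independence assumption: a consistent pair of unit left and right singular vectors
`vec U`, `vec V` for `σ₋ᵣ(Q(μ, Γ, P))` has `rank V = r`, where `U` and `V` are `n × r`. -/
def LinearIndependenceAssumption (A : Fin (m + 1) → Matrix (Fin n) (Fin n) ℂ) (μ : Fin r → ℂ)
    (Γ : Params r) : Prop :=
  ∃ U V : Matrix (Fin n) (Fin r) ℂ,
    ‖WithLp.toLp 2 U.vec‖ = 1 ∧ ‖WithLp.toLp 2 V.vec‖ = 1 ∧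
    blockQ A μ Γ *ᵥ V.vec = (objective A μ Γ : ℂ) • U.vec ∧
    star U.vec ᵥ* blockQ A μ Γ = (objective A μ Γ : ℂ) • star V.vec ∧
    V.rank = r

end MatPoly

end

/-!
If `μ ∈ Sʳ` lists `r` roots of `det (P + Δ)`, then for every `Γ` the equation
`∑ⱼ Aⱼ V C(μ, Γ)ʲ = -Δ V` has a solution space of dimension at least `r`.  On the vectors `vec V`
the norm of `Q(μ, Γ, P)` is at most `‖Δ‖₂`, so `σ₋ᵣ(Q(μ, Γ, P)) ≤ ‖Δ‖₂`.

Conversely, let `Γ` maximize `σ = σ₋ᵣ(Q(μ, Γ, P)) > 0` with simple singular value and singular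
vectors `vec U`, `vec V`.  The first-order conditions in `Γ` annihilate the strict triangle of a
matrix built from `U* A(·) V` and powers of `C(μ, Γ)`, and a commutation argument turns this into
`U* U = V* V`.  If `V` has full column rank, then `Δ = -σ U V⁺` has norm `σ` and satisfies
`∑ⱼ Aⱼ V C(μ, Γ)ʲ = -Δ V`, so the characteristic polynomial of `C(μ, Γ)` divides `det (P + Δ)`.

A maximizing `Γ` exists when all `P[μ_k, μ_l]` are invertible, because large `Γ` make `σ₋ᵣ` small:
`γ_{il}` enters block `(i, l)` of `Q` only as `γ_{il} P[μ_l, μ_i]`, so that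
`σ₋ᵣ(Q) |γ_{il}|` is bounded in terms of the entries `γ` of smaller gap.
-/

noncomputable section

namespace MatPoly

open Module Polynomial Filter Topology

/-! ### Extremal properties of singular values -/

section SingularValues

variable {𝕜 E F : Type*} [RCLike 𝕜] [NormedAddCommGroup E] [InnerProductSpace 𝕜 E]
  [NormedAddCommGroup F] [InnerProductSpace 𝕜 F] [FiniteDimensional 𝕜 E]

theorem exists_mem_inf_ne_zero {K V : Type*} [Field K] [AddCommGroup V] [Module K V]
    [FiniteDimensional K V] {W W' : Submodule K V}
    (h : finrank K V < finrank K W + finrank K W') : ∃ x ∈ W ⊓ W', x ≠ 0 := by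
  refine Submodule.exists_mem_ne_zero_of_ne_bot fun hbot => ?_
  have hsum := Submodule.finrank_sup_add_finrank_inf_eq W W'
  have hle := Submodule.finrank_le (W ⊔ W')
  rw [hbot, finrank_bot] at hsum
  omega

theorem eventually_mul_norm_lt_norm_add_smul (T : E →ₗ[𝕜] F) {D : ℝ → E →ₗ[𝕜] F}
    (hD : Continuous fun p : ℝ × E => D p.1 p.2) {W : Submodule 𝕜 E} {c : ℝ}
    (hW : ∀ x ∈ W, c * ‖x‖ ≤ ‖T x‖)
    (hpos : ∀ x ∈ W, x ≠ 0 → c * ‖x‖ = ‖T x‖ → 0 < RCLike.re (inner 𝕜 (T x) (D 0 x))) :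
    ∀ᶠ t : ℝ in 𝓝[>] 0, ∀ x ∈ W, x ≠ 0 → c * ‖x‖ < ‖T x + (t : 𝕜) • D t x‖ := by
  have hT : Continuous T := T.continuous_of_finiteDimensional
  have : ProperSpace E := FiniteDimensional.proper 𝕜 E
  have hK : IsCompact (Metric.sphere (0 : E) 1 ∩ W) :=
    (isCompact_sphere 0 1).inter_right W.closed_of_finiteDimensional
  let φ : ℝ × E → ℝ := fun p =>
    2 * RCLike.re (inner 𝕜 (T p.2) (D p.1 p.2)) + p.1 * ‖D p.1 p.2‖ ^ 2
  have hφ : Continuous φ := by fun_prop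
  have hexpand (t : ℝ) (x : E) :
      ‖T x + (t : 𝕜) • D t x‖ ^ 2 = ‖T x‖ ^ 2 + t * φ (t, x) := by
    rw [norm_add_sq (𝕜 := 𝕜), inner_smul_right, RCLike.re_ofReal_mul, norm_smul, RCLike.norm_ofReal,
      mul_pow, sq_abs]
    ring
  have hsphere : ∀ᶠ t : ℝ in 𝓝 0, ∀ x ∈ Metric.sphere (0 : E) 1 ∩ W,
      x ∈ Metric.sphere (0 : E) 1 ∩ (W : Set E) → 0 < t → c < ‖T x + (t : 𝕜) • D t x‖ := by
    refine hK.eventually_forall_of_forall_eventually fun x ⟨hx, hxW⟩ => ?_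
    have hx1 : ‖x‖ = 1 := mem_sphere_zero_iff_norm.mp hx
    rcases (hW x hxW).lt_or_eq with hlt | heq
    · have hcont : Continuous fun p : ℝ × E => ‖T p.2 + (p.1 : 𝕜) • D p.1 p.2‖ := by fun_prop
      refine (hcont.tendsto (0, x)).eventually_const_lt ?_ |>.mono fun _ h _ _ => h
      simpa [hx1] using hlt
    · have hφ0 : 0 < φ (0, x) := by
        simpa [φ] using hpos x hxW (norm_ne_zero_iff.mp (hx1 ▸ one_ne_zero)) heq
      filter_upwards [(hφ.tendsto (0, x)).eventually_const_lt hφ0] with p hp ⟨hp1, hpW⟩ ht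
      have hle : c ≤ ‖T p.2‖ := by simpa [mem_sphere_zero_iff_norm.mp hp1] using hW p.2 hpW
      refine hle.trans_lt (lt_of_pow_lt_pow_left₀ 2 (norm_nonneg _) ?_)
      rw [hexpand]
      exact lt_add_of_pos_right _ (mul_pos ht hp)
  filter_upwards [nhdsWithin_le_nhds hsphere, self_mem_nhdsWithin] with t ht ht0 x hxW hx0
  have hnx : 0 < ‖x‖ := norm_pos_iff.mpr hx0
  have hu : ((‖x‖⁻¹ : ℝ) : 𝕜) • x ∈ Metric.sphere (0 : E) 1 ∩ W := by
    refine ⟨mem_sphere_zero_iff_norm.mpr ?_, W.smul_mem _ hxW⟩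
    rw [norm_smul, RCLike.norm_ofReal, abs_of_pos (inv_pos.mpr hnx), inv_mul_cancel₀ hnx.ne']
  have hlt := ht _ hu hu ht0
  rwa [map_smul, map_smul, smul_comm, ← smul_add, norm_smul, RCLike.norm_ofReal,
    abs_of_pos (inv_pos.mpr hnx), lt_inv_mul_iff₀' hnx] at hlt

variable [FiniteDimensional 𝕜 F]

/-- The orthonormal basis of right singular vectors of `T`, ordered by decreasing singular value. -/
def rightSingularBasis (T : E →ₗ[𝕜] F) : OrthonormalBasis (Fin (finrank 𝕜 E)) 𝕜 E :=
  T.isSymmetric_adjoint_comp_self.eigenvectorBasis rfl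

theorem adjoint_apply_rightSingularBasis (T : E →ₗ[𝕜] F) (i : Fin (finrank 𝕜 E)) :
    T.adjoint (T (rightSingularBasis T i)) =
      ((T.singularValues i ^ 2 : ℝ) : 𝕜) • rightSingularBasis T i := by
  have h := T.isSymmetric_adjoint_comp_self.apply_eigenvectorBasis rfl i
  rwa [← T.sq_singularValues_fin rfl i] at h

theorem norm_sq_apply_eq_sum (T : E →ₗ[𝕜] F) (x : E) :
    ‖T x‖ ^ 2 = ∑ i : Fin (finrank 𝕜 E),
      T.singularValues i ^ 2 * ‖inner 𝕜 (rightSingularBasis T i) x‖ ^ 2 := by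
  have hcoord (i) : inner 𝕜 (rightSingularBasis T i) (T.adjoint (T x)) =
      ((T.singularValues i ^ 2 : ℝ) : 𝕜) * inner 𝕜 (rightSingularBasis T i) x := by
    rw [LinearMap.adjoint_inner_right, ← LinearMap.adjoint_inner_left,
      adjoint_apply_rightSingularBasis, inner_smul_left, RCLike.conj_ofReal]
  have hK : ((‖T x‖ ^ 2 : ℝ) : 𝕜) = ((∑ i : Fin (finrank 𝕜 E),
      T.singularValues i ^ 2 * ‖inner 𝕜 (rightSingularBasis T i) x‖ ^ 2 : ℝ) : 𝕜) := by
    rw [RCLike.ofReal_pow, ← inner_self_eq_norm_sq_to_K, ← LinearMap.adjoint_inner_right,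
      ← (rightSingularBasis T).sum_inner_mul_inner, RCLike.ofReal_sum]
    refine Finset.sum_congr rfl fun i _ => ?_
    rw [hcoord, RCLike.ofReal_mul, RCLike.ofReal_pow ‖_‖, ← RCLike.conj_mul, inner_conj_symm]
    ring
  exact_mod_cast hK

/-- The span of the first `k` right singular vectors of `T`. -/
def topSpan (T : E →ₗ[𝕜] F) (k : ℕ) : Submodule 𝕜 E :=
  Submodule.span 𝕜 (rightSingularBasis T '' {i | (i : ℕ) < k})

theorem finrank_topSpan (T : E →ₗ[𝕜] F) {k : ℕ} (hk : k ≤ finrank 𝕜 E) :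
    finrank 𝕜 (topSpan T k) = k := by
  have hli : LinearIndependent 𝕜 fun i : {i : Fin (finrank 𝕜 E) // (i : ℕ) < k} =>
      rightSingularBasis T i :=
    (rightSingularBasis T).orthonormal.linearIndependent.comp _ Subtype.val_injective
  have hspan := finrank_span_eq_card hli
  rwa [Set.range_comp' (rightSingularBasis T) Subtype.val, Subtype.range_coe_subtype,
    Fintype.card_subtype, Fin.card_filter_val_lt, min_eq_right hk] at hspan

theorem finrank_orthogonal_topSpan (T : E →ₗ[𝕜] F) {k : ℕ} (hk : k ≤ finrank 𝕜 E) :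
    finrank 𝕜 (topSpan T k)ᗮ = finrank 𝕜 E - k := by
  rw [← (topSpan T k).finrank_add_finrank_orthogonal, finrank_topSpan T hk, Nat.add_sub_cancel_left]

theorem inner_rightSingularBasis_eq_zero_of_mem_topSpan (T : E →ₗ[𝕜] F) {k : ℕ} {x : E}
    (hx : x ∈ topSpan T k) {i : Fin (finrank 𝕜 E)} (hi : k ≤ i) :
    inner 𝕜 (rightSingularBasis T i) x = 0 := by
  suffices topSpan T k ≤ (𝕜 ∙ rightSingularBasis T i)ᗮ from
    Submodule.mem_orthogonal_singleton_iff_inner_right.mp (this hx)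
  rw [topSpan, Submodule.span_le]
  rintro _ ⟨j, hj, rfl⟩
  exact Submodule.mem_orthogonal_singleton_iff_inner_right.mpr
    ((rightSingularBasis T).orthonormal.inner_eq_zero (Fin.val_ne_iff.mp (hj.trans_le hi).ne'))

theorem inner_rightSingularBasis_eq_zero_of_mem_orthogonal (T : E →ₗ[𝕜] F) {k : ℕ} {x : E}
    (hx : x ∈ (topSpan T k)ᗮ) {i : Fin (finrank 𝕜 E)} (hi : i < k) :
    inner 𝕜 (rightSingularBasis T i) x = 0 :=
  Submodule.inner_right_of_mem_orthogonal (Submodule.subset_span (Set.mem_image_of_mem _ hi)) hx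

theorem singularValues_mul_norm_le_of_mem_topSpan (T : E →ₗ[𝕜] F) {k : ℕ} {x : E}
    (hx : x ∈ topSpan T (k + 1)) : T.singularValues k * ‖x‖ ≤ ‖T x‖ := by
  refine le_of_sq_le_sq ?_ (norm_nonneg _)
  rw [mul_pow, norm_sq_apply_eq_sum, ← (rightSingularBasis T).sum_sq_norm_inner_right,
    Finset.mul_sum]
  refine Finset.sum_le_sum fun i _ => ?_
  rcases Nat.lt_or_ge i (k + 1) with hi | hi
  · have := T.singularValues_nonneg k
    have := T.singularValues_antitone (Nat.lt_succ_iff.mp hi)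
    gcongr
  · simp [inner_rightSingularBasis_eq_zero_of_mem_topSpan T hx hi]

theorem singularValues_mul_norm_lt_of_mem_topSpan (T : E →ₗ[𝕜] F) {k : ℕ}
    (hgap : ∀ j < k, T.singularValues k < T.singularValues j) {x : E} (hx : x ∈ topSpan T k)
    (hx0 : x ≠ 0) : T.singularValues k * ‖x‖ < ‖T x‖ := by
  rcases k with _ | k
  · simp [topSpan, hx0] at hx
  · calc T.singularValues (k + 1) * ‖x‖ < T.singularValues k * ‖x‖ :=
          mul_lt_mul_of_pos_right (hgap k k.lt_succ_self) (norm_pos_iff.mpr hx0)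
      _ ≤ ‖T x‖ := singularValues_mul_norm_le_of_mem_topSpan T hx

theorem norm_apply_le_of_mem_orthogonal_topSpan (T : E →ₗ[𝕜] F) {k : ℕ} {x : E}
    (hx : x ∈ (topSpan T k)ᗮ) : ‖T x‖ ≤ T.singularValues k * ‖x‖ := by
  have h0 := T.singularValues_nonneg k
  refine le_of_sq_le_sq ?_ (by positivity)
  rw [mul_pow, norm_sq_apply_eq_sum, ← (rightSingularBasis T).sum_sq_norm_inner_right,
    Finset.mul_sum]
  refine Finset.sum_le_sum fun i _ => ?_
  rcases Nat.lt_or_ge i k with hi | hi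
  · simp [inner_rightSingularBasis_eq_zero_of_mem_orthogonal T hx hi]
  · have := T.singularValues_nonneg i
    have := T.singularValues_antitone hi
    gcongr

theorem lt_singularValues_of_forall_mem (T : E →ₗ[𝕜] F) {k : ℕ} {c : ℝ} {W : Submodule 𝕜 E}
    (hW : k < finrank 𝕜 W) (h : ∀ x ∈ W, x ≠ 0 → c * ‖x‖ < ‖T x‖) : c < T.singularValues k := by
  have hk : k < finrank 𝕜 E := hW.trans_le W.finrank_le
  obtain ⟨x, ⟨hxW, hx⟩, hx0⟩ := exists_mem_inf_ne_zero (W := W) (W' := (topSpan T k)ᗮ)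
    (by rw [finrank_orthogonal_topSpan T hk.le]; omega)
  exact lt_of_mul_lt_mul_right
    ((h x hxW hx0).trans_le (norm_apply_le_of_mem_orthogonal_topSpan T hx)) (norm_nonneg x)

theorem singularValues_le_of_forall_mem (T : E →ₗ[𝕜] F) {k : ℕ} {c : ℝ} {W : Submodule 𝕜 E}
    (hk : k < finrank 𝕜 E) (hW : finrank 𝕜 E ≤ k + finrank 𝕜 W)
    (h : ∀ x ∈ W, ‖T x‖ ≤ c * ‖x‖) : T.singularValues k ≤ c := by
  obtain ⟨x, ⟨hxW, hx⟩, hx0⟩ := exists_mem_inf_ne_zero (W := W) (W' := topSpan T (k + 1))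
    (by rw [finrank_topSpan T hk]; omega)
  exact le_of_mul_le_mul_right
    ((singularValues_mul_norm_le_of_mem_topSpan T hx).trans (h x hxW)) (norm_pos_iff.mpr hx0)

theorem singularValues_le_add (T S : E →ₗ[𝕜] F) {c : ℝ} (k : ℕ) (hc : 0 ≤ c)
    (h : ∀ x, ‖T x - S x‖ ≤ c * ‖x‖) : T.singularValues k ≤ S.singularValues k + c := by
  rcases lt_or_ge k (finrank 𝕜 E) with hk | hk
  · refine singularValues_le_of_forall_mem T hk
      (by rw [finrank_orthogonal_topSpan S hk.le]; omega) fun x hx => ?_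
    calc ‖T x‖ ≤ ‖S x‖ + ‖T x - S x‖ := norm_le_insert' _ _
      _ ≤ S.singularValues k * ‖x‖ + c * ‖x‖ :=
        add_le_add (norm_apply_le_of_mem_orthogonal_topSpan S hx) (h x)
      _ = (S.singularValues k + c) * ‖x‖ := (add_mul _ _ _).symm
  · rw [T.singularValues_of_finrank_le hk]
    exact add_nonneg (S.singularValues_nonneg k) hc

theorem inner_eq_zero_of_mem_topSpan (T : E →ₗ[𝕜] F) {k : ℕ} {v x : E}
    (hv : T.adjoint (T v) = ((T.singularValues k ^ 2 : ℝ) : 𝕜) • v)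
    (hgap : ∀ j < k, T.singularValues k < T.singularValues j) (hx : x ∈ topSpan T k) :
    inner 𝕜 x v = 0 := by
  suffices topSpan T k ≤ (𝕜 ∙ v)ᗮ from
    Submodule.mem_orthogonal_singleton_iff_inner_left.mp (this hx)
  rw [topSpan, Submodule.span_le]
  rintro _ ⟨i, hi, rfl⟩
  have hsymm : inner 𝕜 (T.adjoint (T (rightSingularBasis T i))) v =
      inner 𝕜 (rightSingularBasis T i) (T.adjoint (T v)) := by
    rw [LinearMap.adjoint_inner_left, LinearMap.adjoint_inner_right]
  rw [adjoint_apply_rightSingularBasis, hv, inner_smul_left, inner_smul_right,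
    RCLike.conj_ofReal] at hsymm
  have hne : T.singularValues i ^ 2 ≠ T.singularValues k ^ 2 :=
    (pow_lt_pow_left₀ (hgap i hi) (T.singularValues_nonneg k) two_ne_zero).ne'
  refine Submodule.mem_orthogonal_singleton_iff_inner_left.mpr
    ((mul_eq_mul_right_iff.mp hsymm).resolve_left ?_)
  exact_mod_cast hne

theorem norm_sq_apply_add_smul_sub (T : E →ₗ[𝕜] F) {σ : ℝ} {v y : E}
    (hv : T.adjoint (T v) = ((σ ^ 2 : ℝ) : 𝕜) • v) (hyv : inner 𝕜 y v = 0) (a : 𝕜) :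
    ‖T (y + a • v)‖ ^ 2 - (σ * ‖y + a • v‖) ^ 2 = ‖T y‖ ^ 2 - (σ * ‖y‖) ^ 2 := by
  have hTv (x : E) : inner 𝕜 (T x) (T v) = (σ : 𝕜) ^ 2 * inner 𝕜 x v := by
    rw [← LinearMap.adjoint_inner_right, hv, inner_smul_right, RCLike.ofReal_pow]
  have hnorm : ‖T v‖ ^ 2 = σ ^ 2 * ‖v‖ ^ 2 := by
    have := hTv v
    rw [inner_self_eq_norm_sq_to_K, inner_self_eq_norm_sq_to_K] at this
    exact_mod_cast this
  rw [map_add, map_smul, mul_pow, norm_add_sq (𝕜 := 𝕜), norm_add_sq (𝕜 := 𝕜), inner_smul_right,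
    inner_smul_right, hTv, hyv, norm_smul, norm_smul, mul_pow, mul_pow, hnorm]
  simp only [mul_zero, map_zero]
  ring

theorem exists_lt_singularValues_add_smul (T : E →ₗ[𝕜] F) {D : ℝ → E →ₗ[𝕜] F}
    (hD : Continuous fun p : ℝ × E => D p.1 p.2) {k : ℕ} (hk : k ≤ finrank 𝕜 E) {v : E}
    (hv : T.adjoint (T v) = ((T.singularValues k ^ 2 : ℝ) : 𝕜) • v)
    (hgap : ∀ j < k, T.singularValues k < T.singularValues j)
    (hpos : 0 < RCLike.re (inner 𝕜 (T v) (D 0 v))) :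
    ∃ t : ℝ, T.singularValues k < (T + (t : 𝕜) • D t).singularValues k := by
  have hσ : 0 ≤ T.singularValues k := T.singularValues_nonneg k
  have horth {y : E} (hy : y ∈ topSpan T k) : inner 𝕜 y v = 0 :=
    inner_eq_zero_of_mem_topSpan T hv hgap hy
  have hvmem : v ∉ topSpan T k := fun h => by
    simp [inner_self_eq_zero.mp (horth h)] at hpos
  have hW : k < finrank 𝕜 (topSpan T k ⊔ 𝕜 ∙ v : Submodule 𝕜 E) := by
    simpa only [finrank_topSpan T hk] using Submodule.finrank_lt_finrank_of_lt
      (left_lt_sup.mpr fun h => hvmem ((Submodule.span_singleton_le_iff_mem v _).mp h))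
  have hlt {y : E} (hy : y ∈ topSpan T k) (hy0 : y ≠ 0) (a : 𝕜) :
      T.singularValues k * ‖y + a • v‖ < ‖T (y + a • v)‖ := by
    have hsq := pow_lt_pow_left₀ (singularValues_mul_norm_lt_of_mem_topSpan T hgap hy hy0)
      (mul_nonneg hσ (norm_nonneg y)) two_ne_zero
    rw [← sub_pos, ← norm_sq_apply_add_smul_sub T hv (horth hy) a, sub_pos] at hsq
    exact lt_of_pow_lt_pow_left₀ 2 (norm_nonneg _) hsq
  have hle {y : E} (hy : y ∈ topSpan T k) (a : 𝕜) :
      T.singularValues k * ‖y + a • v‖ ≤ ‖T (y + a • v)‖ := by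
    rcases eq_or_ne y 0 with rfl | hy0
    · have hsq := norm_sq_apply_add_smul_sub T hv (inner_zero_left v) a
      rw [map_zero, norm_zero, norm_zero, mul_zero, sub_self, sub_eq_zero] at hsq
      exact (pow_le_pow_iff_left₀ (by positivity) (norm_nonneg _) two_ne_zero).mp hsq.ge
    · exact (hlt hy hy0 a).le
  have hev := eventually_mul_norm_lt_norm_add_smul T hD (W := topSpan T k ⊔ 𝕜 ∙ v)
    (c := T.singularValues k) ?_ ?_
  · obtain ⟨t, ht⟩ := hev.exists
    exact ⟨t, lt_singularValues_of_forall_mem _ hW ht⟩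
  all_goals
    simp only [Submodule.mem_sup, Submodule.mem_span_singleton]
    rintro _ ⟨y, hy, _, ⟨a, rfl⟩, rfl⟩
  · exact hle hy a
  · intro hx0 heq
    have hy0 : y = 0 := by_contra fun hy0 => (hlt hy hy0 a).ne heq
    rw [hy0, zero_add] at hx0 ⊢
    rw [map_smul, map_smul, inner_smul_left, inner_smul_right, ← mul_assoc, RCLike.conj_mul,
      ← RCLike.ofReal_pow, RCLike.re_ofReal_mul]
    exact mul_pos (pow_pos (norm_pos_iff.mpr (left_ne_zero_of_smul hx0)) 2) hpos

end SingularValues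

/-! ### Divided differences of polynomials -/

section DivDiff

open Finset (univ)
open Lagrange (nodal nodal_monic)

variable {R : Type*} [CommRing R] {k : ℕ}

/-- The divided difference `p[x₀, …, xₖ]` of a polynomial, encoded as the coefficient of `Xᵏ` in
the Hermite interpolant `p %ₘ ∏ᵢ (X - xᵢ)`; it is linear in `p` and needs no distinctness of the
nodes. -/
def divDiff (x : Fin (k + 1) → R) : R[X] →ₗ[R] R :=
  lcoeff R k ∘ₗ modByMonicHom (nodal univ x)

theorem divDiff_apply (x : Fin (k + 1) → R) (p : R[X]) :
    divDiff x p = (p %ₘ nodal univ x).coeff k := rfl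

theorem nodal_succAbove (x : Fin (k + 1) → R) (i : Fin (k + 1)) :
    nodal univ x = nodal univ (fun t => x (i.succAbove t)) * (X - C (x i)) := by
  rw [Lagrange.nodal, Lagrange.nodal, Fin.prod_univ_succAbove _ i, mul_comm]

theorem nodal_succ (x : Fin (k + 1) → R) :
    nodal univ x = nodal univ (fun t : Fin k => x t.succ) * (X - C (x 0)) := by
  simpa using nodal_succAbove x 0

theorem nodal_castSucc (x : Fin (k + 1) → R) :
    nodal univ x = nodal univ (fun t : Fin k => x t.castSucc) * (X - C (x (Fin.last k))) := by
  simpa using nodal_succAbove x (Fin.last k)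

theorem divDiff_zero (x : Fin 1 → R) (p : R[X]) : divDiff x p = p.eval (x 0) := by
  rw [divDiff_apply, Lagrange.nodal, Fin.prod_univ_one, modByMonic_X_sub_C_eq_C_eval, coeff_C_zero]

variable [Nontrivial R]

theorem coeff_nodal (y : Fin k → R) : (nodal univ y).coeff k = 1 := by
  simpa [Lagrange.natDegree_nodal] using (nodal_monic (s := univ) (v := y)).coeff_natDegree

theorem degree_modByMonic_nodal_lt (y : Fin k → R) (p : R[X]) :
    (p %ₘ nodal univ y).degree < k := by
  simpa [Lagrange.degree_nodal] using degree_modByMonic_lt p (nodal_monic (s := univ) (v := y))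

theorem modByMonic_nodal_eq_self {y : Fin k → R} {p : R[X]} (hp : p.degree < k) :
    p %ₘ nodal univ y = p :=
  (modByMonic_eq_self_iff nodal_monic).mpr (by simpa [Lagrange.degree_nodal] using hp)

/-- Newton's form of the interpolant: adding a node `a` to the nodes `y` changes it by a multiple
of `∏ᵢ (X - yᵢ)`. -/
theorem modByMonic_nodal_eq_add (p : R[X]) {y : Fin k → R} {x : Fin (k + 1) → R} {a : R}
    (h : nodal univ x = nodal univ y * (X - C a)) :
    p %ₘ nodal univ x = C (divDiff x p) * nodal univ y + p %ₘ nodal univ y := by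
  have hdeg : (p %ₘ nodal univ x - C (divDiff x p) * nodal univ y).degree < k := by
    rw [degree_lt_iff_coeff_zero]
    intro j hj
    rw [coeff_sub, coeff_C_mul]
    rcases hj.eq_or_lt with rfl | hj
    · rw [coeff_nodal, mul_one, divDiff_apply, sub_self]
    · rw [coeff_eq_zero_of_degree_lt ((degree_modByMonic_nodal_lt x p).trans_le (mod_cast hj)),
        coeff_eq_zero_of_natDegree_lt (by simpa [Lagrange.natDegree_nodal] using hj), mul_zero,
        sub_zero]
  have hdvd : nodal univ y ∣ p - (p %ₘ nodal univ x - C (divDiff x p) * nodal univ y) := by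
    refine ⟨(X - C a) * (p /ₘ nodal univ x) + C (divDiff x p), ?_⟩
    linear_combination -modByMonic_add_div p (nodal univ x) + (p /ₘ nodal univ x) * h
  have hmod := (modByMonic_eq_zero_iff_dvd nodal_monic).mpr hdvd
  rw [sub_modByMonic, modByMonic_nodal_eq_self hdeg] at hmod
  linear_combination -hmod

theorem divDiff_sub_divDiff (p : R[X]) {w : Fin k → R} {y z : Fin (k + 1) → R}
    {x : Fin (k + 2) → R} {a b : R} (hy : nodal univ y = nodal univ w * (X - C a))
    (hz : nodal univ z = nodal univ w * (X - C b))
    (hx : nodal univ x = nodal univ w * (X - C a) * (X - C b)) :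
    divDiff y p - divDiff z p = (a - b) * divDiff x p := by
  have hxy := modByMonic_nodal_eq_add p (hx.trans (by rw [hy]) : nodal univ x = nodal univ y * _)
  have hxz := modByMonic_nodal_eq_add p
    (hx.trans (by rw [hz, mul_right_comm]) : nodal univ x = nodal univ z * _)
  have hyz : p %ₘ nodal univ y - p %ₘ nodal univ z =
      C ((a - b) * divDiff x p) * nodal univ w := by
    rw [C_mul, C_sub]
    linear_combination hxz - hxy + C (divDiff x p) * (hz - hy)
  have hcoeff := congrArg (coeff · k) hyz
  simp only [coeff_sub, coeff_C_mul, coeff_nodal, mul_one] at hcoeff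
  exact hcoeff

/-- The Leibniz rule for the product `X * p`. -/
theorem divDiff_X_mul (x : Fin (k + 2) → R) (p : R[X]) :
    divDiff x (X * p) = x 0 * divDiff x p + divDiff (fun t : Fin (k + 1) => x t.succ) p := by
  set y : Fin (k + 1) → R := fun t => x t.succ
  have hnewton := modByMonic_nodal_eq_add p (nodal_succ x)
  have hx := (degree_lt_iff_coeff_zero _ _).mp (degree_modByMonic_nodal_lt x p)
  have hy := (degree_lt_iff_coeff_zero _ _).mp (degree_modByMonic_nodal_lt y p)
  have hmod : (X * p) %ₘ nodal univ x =
      C (x 0) * (p %ₘ nodal univ x) + (X - C (x 0)) * (p %ₘ nodal univ y) := by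
    have hsplit : X * p =
        (C (x 0) * (p %ₘ nodal univ x) + (X - C (x 0)) * (p %ₘ nodal univ y)) +
          nodal univ x * (C (divDiff x p) + X * (p /ₘ nodal univ x)) := by
      linear_combination -X * modByMonic_add_div p (nodal univ x) +
        (X - C (x 0)) * hnewton - C (divDiff x p) * nodal_succ x
    rw [hsplit, add_modByMonic, self_mul_modByMonic nodal_monic, add_zero]
    refine modByMonic_nodal_eq_self ((degree_lt_iff_coeff_zero _ _).mpr fun j hj => ?_)
    obtain ⟨j, rfl⟩ : ∃ i, j = i + 1 := ⟨j - 1, by omega⟩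
    simp [sub_mul, coeff_X_mul, hx _ hj, hy j (by omega), hy (j + 1) (by omega)]
  rw [divDiff_apply, hmod]
  simp [sub_mul, coeff_X_mul, divDiff_apply, hy (k + 1) le_rfl, y]

theorem divDiff_one_succ (x : Fin (k + 2) → R) : divDiff x 1 = 0 := by
  rw [divDiff_apply, modByMonic_nodal_eq_self (by rw [degree_one]; exact_mod_cast Nat.succ_pos _)]
  simp [coeff_one]

theorem divDiff_const (k : ℕ) (a : R) (p : R[X]) :
    divDiff (fun _ : Fin (k + 1) => a) p = (taylor a p).coeff k := by
  have hn : nodal univ (fun _ : Fin (k + 1) => a) = (X - C a) ^ (k + 1) := by simp [Lagrange.nodal]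
  have hdeg : (p %ₘ (X - C a) ^ (k + 1)).natDegree ≤ k := by
    have := degree_modByMonic_nodal_lt (fun _ : Fin (k + 1) => a) p
    rw [hn] at this
    exact natDegree_le_of_degree_le (Order.lt_succ_iff.mp this)
  rw [divDiff_apply, hn]
  conv_rhs => rw [← modByMonic_add_div p ((X - C a) ^ (k + 1))]
  rw [map_add, taylor_mul, taylor_pow, show taylor a (X - C a) = X by simp, coeff_add,
    coeff_X_pow_mul', if_neg (by omega), add_zero]
  rcases hdeg.eq_or_lt with h | h
  · have := coeff_taylor_natDegree (f := p %ₘ (X - C a) ^ (k + 1)) (r := a)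
    rw [h] at this
    rw [this, leadingCoeff, h]
  · rw [coeff_eq_zero_of_natDegree_lt h, coeff_eq_zero_of_natDegree_lt (by rwa [natDegree_taylor])]

end DivDiff

theorem iteratedDeriv_eval {𝕜 : Type*} [NontriviallyNormedField 𝕜] (p : 𝕜[X]) (k : ℕ) :
    iteratedDeriv k (fun z => p.eval z) = fun z => (derivative^[k] p).eval z := by
  induction k generalizing p with
  | zero => simp
  | succ k ih =>
    have hderiv : _root_.deriv (fun z => p.eval z) = fun z => p.derivative.eval z :=
      funext fun _ => p.deriv
    rw [iteratedDeriv_succ', hderiv, ih, Function.iterate_succ_apply]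

theorem taylor_coeff_eq_iteratedDeriv_div (p : ℂ[X]) (k : ℕ) (a : ℂ) :
    (taylor a p).coeff k = iteratedDeriv k (fun z => p.eval z) a / k.factorial := by
  rw [iteratedDeriv_eval, taylor_coeff, ← factorial_smul_hasseDeriv]
  simp [Nat.factorial_ne_zero]

theorem dividedDiff_eval (p : ℂ[X]) (k : ℕ) (x : Fin (k + 1) → ℂ) :
    dividedDiff (fun z => p.eval z) k x = divDiff x p := by
  induction k with
  | zero => rw [dividedDiff, divDiff_zero]
  | succ k ih =>
    rw [dividedDiff]
    split_ifs with hends hex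
    · rw [ih, ih, div_eq_iff (sub_ne_zero.mpr hends.symm), mul_comm]
      exact divDiff_sub_divDiff p (w := fun t : Fin k => x t.succ.castSucc)
        (nodal_castSucc _) (nodal_succ _) ((nodal_succ x).trans (by rw [nodal_castSucc]; rfl))
    · rw [ih, ih, div_eq_iff (sub_ne_zero.mpr hex.choose_spec), mul_comm]
      obtain ⟨j, hj⟩ : ∃ j : Fin (k + 1), hex.choose = j.succ :=
        ⟨_, (Fin.succ_pred _ fun h => hex.choose_spec (by rw [h])).symm⟩
      rw [hj]
      refine divDiff_sub_divDiff p (w := fun t : Fin k => x (j.succAbove t).succ)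
        (nodal_succAbove _ j) ?_ ((nodal_succ x).trans (by rw [nodal_succAbove _ j]))
      obtain _ | k := k
      · simp [Lagrange.nodal]
      · rw [nodal_succ]
        simp
    · push Not at hex
      rw [← taylor_coeff_eq_iteratedDeriv_div, ← divDiff_const]
      exact congrArg (divDiff · p) (funext fun t => (hex t).symm)

/-! ### The polynomial functional calculus of a triangular matrix -/

section BlockMatrix

variable {n m r : ℕ}

theorem gam_eq_zero (Γ : Params r) {i l : Fin r} (h : ¬ l < i) : gam Γ i l = 0 := dif_neg h

theorem triC_eq_diagonal_add (μ : Fin r → ℂ) (Γ : Params r) (l i : Fin r) :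
    triC μ Γ l i = (if l = i then μ l else 0) + gam Γ i l := by
  rw [triC, Matrix.of_apply]
  split_ifs with h
  · rw [gam_eq_zero Γ h.not_lt, add_zero, h]
  · rw [zero_add]

theorem strictMono_of_prod_gam_ne_zero (Γ : Params r) {k : ℕ} {s : Fin (k + 1) → Fin r}
    (h : ∏ t : Fin k, gam Γ (s t.succ) (s t.castSucc) ≠ 0) : StrictMono s := by
  refine Fin.strictMono_iff_lt_succ.mpr fun t => ?_
  by_contra hlt
  exact Finset.prod_ne_zero_iff.mp h t (Finset.mem_univ t) (gam_eq_zero Γ hlt)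

/-- The contribution of the chains of length `k` from `l` to `i` to entry `(l, i)` of
`p (C(μ, Γ))`, as a linear functional of `p`.  The sum runs over all index sequences, since
`∏ gam` vanishes on those that are not increasing. -/
def chainPart (μ : Fin r → ℂ) (Γ : Params r) (k : ℕ) (l i : Fin r) : ℂ[X] →ₗ[ℂ] ℂ :=
  ∑ s : Fin (k + 1) → Fin r with s 0 = l ∧ s (Fin.last k) = i,
    (∏ t : Fin k, gam Γ (s t.succ) (s t.castSucc)) • divDiff fun t => μ (s t)

theorem chainPart_apply (μ : Fin r → ℂ) (Γ : Params r) (k : ℕ) (l i : Fin r) (p : ℂ[X]) :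
    chainPart μ Γ k l i p = ∑ s : Fin (k + 1) → Fin r with s 0 = l ∧ s (Fin.last k) = i,
      (∏ t : Fin k, gam Γ (s t.succ) (s t.castSucc)) * divDiff (fun t => μ (s t)) p := by
  simp [chainPart]

theorem chainPart_zero (μ : Fin r → ℂ) (Γ : Params r) (l i : Fin r) (p : ℂ[X]) :
    chainPart μ Γ 0 l i p = if l = i then p.eval (μ i) else 0 := by
  rw [chainPart_apply, Finset.sum_filter, Fintype.sum_eq_single fun _ => l]
  · rcases eq_or_ne l i with rfl | h <;> simp [divDiff_zero, *]
  · intro s hs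
    refine if_neg fun h => hs (funext fun t => ?_)
    rw [Fin.fin_one_eq_zero t]
    exact h.1

theorem chainPart_eq_zero_of_le (μ : Fin r → ℂ) (Γ : Params r) {k : ℕ} (hk : r ≤ k)
    (l i : Fin r) : chainPart μ Γ k l i = 0 := by
  refine Finset.sum_eq_zero fun s _ => smul_eq_zero_of_left ?_ _
  by_contra h
  have := Fintype.card_le_of_injective s (strictMono_of_prod_gam_ne_zero Γ h).injective
  simp only [Fintype.card_fin] at this
  omega

theorem chainPart_succ_eq_zero (μ : Fin r → ℂ) (Γ : Params r) (k : ℕ) {l i : Fin r}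
    (h : ¬ l < i) : chainPart μ Γ (k + 1) l i = 0 := by
  refine Finset.sum_eq_zero fun s hs => smul_eq_zero_of_left ?_ _
  by_contra hne
  obtain ⟨rfl, rfl⟩ := (Finset.mem_filter.mp hs).2
  exact h (strictMono_of_prod_gam_ne_zero Γ hne (Fin.last_pos (n := k)))

/-- Splitting off the first step of each chain. -/
theorem sum_gam_mul_chainPart (μ : Fin r → ℂ) (Γ : Params r) (k : ℕ) (l i : Fin r) (p : ℂ[X]) :
    ∑ j, gam Γ j l * chainPart μ Γ k j i p =
      ∑ s : Fin (k + 2) → Fin r with s 0 = l ∧ s (Fin.last (k + 1)) = i,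
        (∏ t : Fin (k + 1), gam Γ (s t.succ) (s t.castSucc)) *
          divDiff (fun t : Fin (k + 1) => μ (s t.succ)) p := by
  symm
  rw [Finset.sum_filter, ← (Fin.consEquiv fun _ : Fin (k + 2) => Fin r).sum_comp,
    Fintype.sum_prod_type, Fintype.sum_eq_single l]
  · symm
    simp only [chainPart_apply, Finset.sum_filter, Finset.mul_sum]
    rw [Finset.sum_comm]
    refine Fintype.sum_congr _ _ fun u => ?_
    rw [Fintype.sum_eq_single (u 0)]
    · simp only [Fin.consEquiv_apply, Fin.cons_zero, ← Fin.succ_last, Fin.cons_succ, true_and,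
        Fin.prod_univ_succ (n := k), Fin.castSucc_zero, ← Fin.succ_castSucc, mul_ite, mul_zero,
        mul_assoc]
    · intro j hj
      rw [if_neg fun h => hj h.1.symm, mul_zero]
  · intro j hj
    refine Finset.sum_eq_zero fun u _ => if_neg fun h => hj ?_
    simpa using h.1

theorem chainPart_X_mul (μ : Fin r → ℂ) (Γ : Params r) (k : ℕ) (l i : Fin r) (p : ℂ[X]) :
    chainPart μ Γ (k + 1) l i (X * p) =
      μ l * chainPart μ Γ (k + 1) l i p + ∑ j, gam Γ j l * chainPart μ Γ k j i p := by
  rw [sum_gam_mul_chainPart, chainPart_apply, chainPart_apply, Finset.mul_sum,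
    ← Finset.sum_add_distrib]
  refine Finset.sum_congr rfl fun s hs => ?_
  rw [divDiff_X_mul, (Finset.mem_filter.mp hs).2.1]
  ring

theorem chainPart_succ_one (μ : Fin r → ℂ) (Γ : Params r) (k : ℕ) (l i : Fin r) :
    chainPart μ Γ (k + 1) l i 1 = 0 := by
  simp [chainPart_apply, divDiff_one_succ]

/-- The sum over all chains from `l` to `i`. -/
def chainTotal (μ : Fin r → ℂ) (Γ : Params r) (l i : Fin r) : ℂ[X] →ₗ[ℂ] ℂ :=
  ∑ k ∈ Finset.range r, chainPart μ Γ k l i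

theorem chainTotal_eq_sum_range_succ (μ : Fin r → ℂ) (Γ : Params r) (l i : Fin r) (p : ℂ[X]) :
    chainTotal μ Γ l i p =
      ∑ k ∈ Finset.range r, chainPart μ Γ (k + 1) l i p + chainPart μ Γ 0 l i p := by
  rw [← Finset.sum_range_succ' (chainPart μ Γ · l i p), Finset.sum_range_succ,
    chainPart_eq_zero_of_le μ Γ le_rfl, LinearMap.zero_apply, add_zero, chainTotal,
    LinearMap.sum_apply]

theorem chainTotal_X_mul (μ : Fin r → ℂ) (Γ : Params r) (l i : Fin r) (p : ℂ[X]) :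
    chainTotal μ Γ l i (X * p) =
      μ l * chainTotal μ Γ l i p + ∑ j, gam Γ j l * chainTotal μ Γ j i p := by
  have hzero : chainPart μ Γ 0 l i (X * p) = μ l * chainPart μ Γ 0 l i p := by
    rcases eq_or_ne l i with rfl | h <;> simp [chainPart_zero, *]
  have hsum : ∑ j, gam Γ j l * chainTotal μ Γ j i p =
      ∑ k ∈ Finset.range r, ∑ j, gam Γ j l * chainPart μ Γ k j i p := by
    simp only [chainTotal, LinearMap.sum_apply, Finset.mul_sum]
    exact Finset.sum_comm
  rw [hsum, chainTotal_eq_sum_range_succ, chainTotal_eq_sum_range_succ, hzero, mul_add,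
    Finset.mul_sum, Finset.sum_congr rfl fun k _ => chainPart_X_mul μ Γ k l i p,
    Finset.sum_add_distrib]
  ring

theorem chainTotal_one (μ : Fin r → ℂ) (Γ : Params r) (l i : Fin r) :
    chainTotal μ Γ l i 1 = (1 : Matrix (Fin r) (Fin r) ℂ) l i := by
  simp [chainTotal_eq_sum_range_succ, chainPart_succ_one, chainPart_zero, Matrix.one_apply]

theorem chainTotal_of_not_lt (μ : Fin r → ℂ) (Γ : Params r) {l i : Fin r} (h : ¬ l < i)
    (p : ℂ[X]) : chainTotal μ Γ l i p = if l = i then p.eval (μ i) else 0 := by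
  simp [chainTotal_eq_sum_range_succ, chainPart_succ_eq_zero _ _ _ h, chainPart_zero]

theorem triC_pow_apply (μ : Fin r → ℂ) (Γ : Params r) (j : ℕ) (l i : Fin r) :
    (triC μ Γ ^ j) l i = chainTotal μ Γ l i (X ^ j) := by
  induction j generalizing l with
  | zero => rw [pow_zero, pow_zero, chainTotal_one]
  | succ j ih =>
    rw [pow_succ', pow_succ', chainTotal_X_mul, Matrix.mul_apply]
    simp only [triC_eq_diagonal_add, ih, add_mul, Finset.sum_add_distrib, ite_mul, zero_mul,
      Finset.sum_ite_eq, Finset.mem_univ, if_true]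

theorem aeval_triC_apply (μ : Fin r → ℂ) (Γ : Params r) (l i : Fin r) (p : ℂ[X]) :
    aeval (triC μ Γ) p l i = chainTotal μ Γ l i p := by
  induction p using Polynomial.induction_on' with
  | add p q hp hq => rw [map_add, map_add, Matrix.add_apply, hp, hq]
  | monomial j a =>
    rw [← smul_X_eq_monomial, map_smul, map_smul, Matrix.smul_apply, map_pow, aeval_X,
      triC_pow_apply]

/-! ### The two forms of `Q(μ, Γ, P)` -/

/-- The entry `(a, b)` of `P` as a polynomial. -/
def entryPoly (A : Fin (m + 1) → Matrix (Fin n) (Fin n) ℂ) (a b : Fin n) : ℂ[X] :=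
  ∑ j : Fin (m + 1), C (A j a b) * X ^ (j : ℕ)

theorem value_apply (A : Fin (m + 1) → Matrix (Fin n) (Fin n) ℂ) (z : ℂ) (a b : Fin n) :
    value A z a b = (entryPoly A a b).eval z := by
  simp only [value, entryPoly, Matrix.sum_apply, Matrix.smul_apply, smul_eq_mul, eval_finsetSum,
    eval_mul, eval_C, eval_pow, eval_X, mul_comm]

theorem matDividedDiff_apply (A : Fin (m + 1) → Matrix (Fin n) (Fin n) ℂ) {k : ℕ}
    (x : Fin (k + 1) → ℂ) (a b : Fin n) :
    matDividedDiff A x a b = divDiff x (entryPoly A a b) := by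
  rw [matDividedDiff, Matrix.of_apply, ← dividedDiff_eval]
  simp only [value_apply]

theorem chainSum_apply (A : Fin (m + 1) → Matrix (Fin n) (Fin n) ℂ) (μ : Fin r → ℂ)
    (Γ : Params r) (i l : Fin r) (a b : Fin n) :
    chainSum A μ Γ i l a b = chainTotal μ Γ l i (entryPoly A a b) := by
  rw [chainSum, chainTotal, Matrix.sum_apply, LinearMap.sum_apply]
  refine Finset.sum_congr rfl fun k _ => ?_
  rw [Matrix.sum_apply, chainPart_apply, Finset.sum_filter, Finset.sum_filter]
  refine Fintype.sum_congr _ _ fun s => ?_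
  simp only [Matrix.smul_apply, smul_eq_mul, matDividedDiff_apply]
  by_cases hs : StrictMono s
  · simp [hs]
  · simp [hs, not_imp_comm.mp (strictMono_of_prod_gam_ne_zero Γ) hs]

theorem blockQ_apply (A : Fin (m + 1) → Matrix (Fin n) (Fin n) ℂ) (μ : Fin r → ℂ)
    (Γ : Params r) (p q : Fin r × Fin n) :
    blockQ A μ Γ p q = chainTotal μ Γ q.1 p.1 (entryPoly A p.2 q.2) := by
  rw [blockQ, Matrix.of_apply]
  split_ifs with hlt heq
  · rw [chainSum_apply]
  · rw [chainTotal_of_not_lt _ _ hlt, if_pos heq.symm, value_apply]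
  · rw [chainTotal_of_not_lt _ _ hlt, if_neg (Ne.symm heq)]

theorem kronQ_apply (A : Fin (m + 1) → Matrix (Fin n) (Fin n) ℂ) (μ : Fin r → ℂ)
    (Γ : Params r) (p q : Fin r × Fin n) :
    kronQ A μ Γ p q = aeval (triC μ Γ) (entryPoly A p.2 q.2) q.1 p.1 := by
  rw [kronQ, entryPoly, map_sum, Matrix.sum_apply, Matrix.sum_apply]
  refine Fintype.sum_congr _ _ fun j => ?_
  rw [map_mul, aeval_C, map_pow, aeval_X, ← Algebra.smul_def, Matrix.smul_apply,
    Matrix.kronecker_apply, Matrix.transpose_apply, smul_eq_mul, mul_comm]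

theorem kronQ_eq_blockQ (A : Fin (m + 1) → Matrix (Fin n) (Fin n) ℂ) (μ : Fin r → ℂ)
    (Γ : Params r) : kronQ A μ Γ = blockQ A μ Γ := by
  ext p q
  rw [kronQ_apply, aeval_triC_apply, blockQ_apply]

end BlockMatrix

/-! ### Kernels of matrix polynomials evaluated at a triangular matrix -/

theorem map_C_vecMulVec {R ι : Type*} [CommSemiring R] (v l : ι → R) :
    (Matrix.vecMulVec v l).map C = Matrix.vecMulVec (C ∘ v) (C ∘ l) := by
  ext a b : 2
  simp [Matrix.vecMulVec_apply]

section PolyAct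

variable {K Y ι : Type*} [Field K] [AddCommGroup Y] [Module K Y] [Fintype ι]

/-- The action of a matrix polynomial `M` on `ι → Y`, where `X` acts on `Y` by `T`. -/
def polyAct (T : End K Y) (M : Matrix ι ι K[X]) : (ι → Y) →ₗ[K] (ι → Y) :=
  LinearMap.pi fun a => ∑ b, aeval T (M a b) ∘ₗ LinearMap.proj b

theorem polyAct_apply (T : End K Y) (M : Matrix ι ι K[X]) (x : ι → Y) (a : ι) :
    polyAct T M x a = ∑ b, aeval T (M a b) (x b) := by
  simp [polyAct]

theorem polyAct_mul (T : End K Y) (M N : Matrix ι ι K[X]) (x : ι → Y) :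
    polyAct T (M * N) x = polyAct T M (polyAct T N x) := by
  ext a
  simp only [polyAct_apply, Matrix.mul_apply, map_sum, map_mul, LinearMap.sum_apply,
    End.mul_apply]
  exact Finset.sum_comm

theorem finrank_add_le_finrank_inf_comap {E E' : Type*} [AddCommGroup E] [Module K E]
    [FiniteDimensional K E] [AddCommGroup E'] [Module K E'] [FiniteDimensional K E']
    (f : E →ₗ[K] E') {F : Submodule K E} {F₁ Z : Submodule K E'} (hf : ∀ x ∈ F, f x ∈ F₁)
    (hZ : Z ≤ F₁) :
    finrank K F + finrank K Z ≤ finrank K F₁ + finrank K (F ⊓ Z.comap f : Submodule K E) := by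
  let Z' : Submodule K F₁ := Z.comap F₁.subtype
  let g : F →ₗ[K] F₁ ⧸ Z' := Z'.mkQ ∘ₗ f.restrict hf
  have hker : finrank K (LinearMap.ker g) ≤ finrank K (F ⊓ Z.comap f : Submodule K E) := by
    rw [((LinearMap.ker g).equivMapOfInjective F.subtype F.injective_subtype).finrank_eq]
    refine Submodule.finrank_mono ?_
    rintro _ ⟨x, hx, rfl⟩
    exact ⟨x.2, by simpa [Z', g] using hx⟩
  have hZ' : finrank K Z' = finrank K Z := (Submodule.comapSubtypeEquivOfLe hZ).finrank_eq
  have := g.finrank_range_add_finrank_ker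
  have := Submodule.finrank_le (LinearMap.range g)
  have := Z'.finrank_quotient_add_finrank
  omega

variable [DecidableEq ι]

/-- For `l ⬝ᵥ v = 1` this is a matrix polynomial of determinant `X - μ`: it multiplies `v` by
`X - μ` and fixes the kernel of `l`. -/
def linearFactor (μ : K) (v l : ι → K) : Matrix ι ι K[X] :=
  1 + (X - C μ - 1) • (Matrix.vecMulVec v l).map C

theorem det_linearFactor (μ : K) {v l : ι → K} (hl : l ⬝ᵥ v = 1) :
    (linearFactor μ v l).det = X - C μ := by
  have hlv : (C ∘ l : ι → K[X]) ⬝ᵥ (C ∘ v) = 1 := by simpa [dotProduct] using congrArg C hl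
  rw [linearFactor, map_C_vecMulVec, ← Matrix.smul_vecMulVec, Matrix.vecMulVec_eq Unit,
    Matrix.det_one_add_replicateCol_mul_replicateRow, dotProduct_smul, hlv]
  simp

theorem eq_mul_one_add_sub_smul_of_isIdempotentElem {R B : Type*} [CommRing R] [Ring B]
    [Algebra R B] {c : R} {M p q : B} (hp : IsIdempotentElem p) (hq : q * p = q)
    (hM : M * p = c • q) : M = (M - M * p + q) * (1 + (c - 1) • p) := by
  have hkill : (M - M * p + q) * p = q := by
    rw [add_mul, sub_mul, mul_assoc, hp.eq, sub_self, zero_add, hq]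
  rw [mul_add, mul_one, mul_smul_comm, hkill, hM, sub_smul, one_smul]
  abel

theorem exists_eq_mul_linearFactor (M : Matrix ι ι K[X]) {μ : K} {v l : ι → K}
    (hv : M.map (eval μ) *ᵥ v = 0) (hl : l ⬝ᵥ v = 1) :
    ∃ M' : Matrix ι ι K[X], M = M' * linearFactor μ v l := by
  have hdvd : ∀ a, X - C μ ∣ (M *ᵥ (C ∘ v)) a := by
    intro a
    rw [dvd_iff_isRoot, IsRoot, Matrix.mulVec, dotProduct, eval_finsetSum]
    simpa [Matrix.mulVec, dotProduct] using congrFun hv a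
  choose w hw using hdvd
  have hlv : (C ∘ l : ι → K[X]) ⬝ᵥ (C ∘ v) = 1 := by simpa [dotProduct] using congrArg C hl
  refine ⟨_, eq_mul_one_add_sub_smul_of_isIdempotentElem (q := Matrix.vecMulVec w (C ∘ l)) ?_ ?_ ?_⟩
  · rw [map_C_vecMulVec, IsIdempotentElem, Matrix.vecMulVec_mul_vecMulVec, hlv]
    simp
  · rw [map_C_vecMulVec, Matrix.vecMulVec_mul_vecMulVec, hlv]
    simp
  · rw [map_C_vecMulVec, Matrix.mul_vecMulVec]
    ext a b : 2
    simp only [Matrix.vecMulVec_apply, Matrix.smul_apply, smul_eq_mul]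
    rw [hw, mul_assoc]

theorem polyAct_linearFactor (T : End K Y) (μ : K) (v l : ι → K) (x : ι → Y) (a : ι) :
    polyAct T (linearFactor μ v l) x a =
      x a + v a • (T (∑ b, l b • x b) - μ • ∑ b, l b • x b - ∑ b, l b • x b) := by
  have hterm : ∀ b, aeval T (linearFactor μ v l a b) (x b) =
      (if a = b then x b else 0) + v a • (T (l b • x b) - μ • (l b • x b) - l b • x b) := by
    intro b
    simp only [linearFactor, Matrix.add_apply, Matrix.one_apply, Matrix.smul_apply,
      Matrix.map_apply, Matrix.vecMulVec_apply, smul_eq_mul, map_add, map_mul, map_sub, aeval_X,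
      aeval_C, map_one, LinearMap.add_apply, End.mul_apply, LinearMap.sub_apply,
      Module.algebraMap_end_apply, End.one_apply, map_smul, smul_sub]
    congr 1
    · split_ifs <;> simp
    · simp only [smul_smul, mul_comm, mul_left_comm]
  rw [polyAct_apply]
  simp only [hterm, Finset.sum_add_distrib, Finset.sum_ite_eq, Finset.mem_univ, if_true,
    ← Finset.smul_sum, Finset.sum_sub_distrib, ← map_sum]

/-- A linear factor gains at least one dimension at a step `W₁ < W₀` of a flag on which `T` acts
by `μ`: besides `W₁`-valued families, it also maps `v ⊗ W₀` to `W₁`-valued families. -/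
theorem finrank_pi_lt_finrank_inf_comap_polyAct [FiniteDimensional K Y] {T : End K Y} {μ : K}
    {W₀ W₁ : Submodule K Y} (hlt : W₁ < W₀) (hT : ∀ y ∈ W₀, T y - μ • y ∈ W₁) {v l : ι → K}
    (hl : l ⬝ᵥ v = 1) :
    finrank K (Submodule.pi Set.univ fun _ : ι => W₁) <
      finrank K (Submodule.pi Set.univ (fun _ : ι => W₀) ⊓
        (Submodule.pi Set.univ fun _ : ι => W₁).comap (polyAct T (linearFactor μ v l)) :
        Submodule K (ι → Y)) := by
  refine Submodule.finrank_lt_finrank_of_lt (SetLike.lt_iff_le_and_exists.mpr ⟨fun x hx => ?_, ?_⟩)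
  · have hx : ∀ b, x b ∈ W₁ := fun b => hx b trivial
    refine ⟨fun a _ => hlt.le (hx a), fun a _ => ?_⟩
    have hsum : ∑ b, l b • x b ∈ W₁ := sum_mem fun b _ => W₁.smul_mem _ (hx b)
    rw [polyAct_linearFactor]
    exact add_mem (hx a) (W₁.smul_mem _ (sub_mem (hT _ (hlt.le hsum)) hsum))
  · obtain ⟨a, ha⟩ : ∃ a, v a ≠ 0 := by
      by_contra! h
      simp [dotProduct, h] at hl
    obtain ⟨y, hy₀, hy₁⟩ := SetLike.exists_of_lt hlt
    have hsum : ∑ b, l b • v b • y = y := by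
      simp only [smul_smul, ← Finset.sum_smul]
      rw [← dotProduct, hl, one_smul]
    refine ⟨fun a => v a • y, ⟨fun a _ => W₀.smul_mem _ hy₀, fun a _ => ?_⟩,
      fun h => hy₁ ((W₁.smul_mem_iff ha).mp (h a trivial))⟩
    rw [polyAct_linearFactor, hsum, smul_sub, add_sub_cancel]
    exact W₁.smul_mem _ (hT y hy₀)

theorem le_finrank_pi_inf_ker_polyAct [FiniteDimensional K Y] (T : End K Y) (r : ℕ)
    (W : ℕ → Submodule K Y) (μ : ℕ → K) (hlt : ∀ k < r, W (k + 1) < W k)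
    (hT : ∀ k < r, ∀ y ∈ W k, T y - μ k • y ∈ W (k + 1)) (M : Matrix ι ι K[X])
    (hM : ∏ k ∈ Finset.range r, (X - C (μ k)) ∣ M.det) :
    r ≤ finrank K (Submodule.pi Set.univ (fun _ : ι => W 0) ⊓ LinearMap.ker (polyAct T M) :
      Submodule K (ι → Y)) := by
  induction r generalizing W μ M with
  | zero => exact Nat.zero_le _
  | succ r ih =>
    rw [Finset.prod_range_succ'] at hM
    have hroot : (M.map (eval (μ 0))).det = 0 := by
      have hdvd := dvd_iff_isRoot.mp ((dvd_mul_left _ _).trans hM)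
      rwa [IsRoot, ← coe_evalRingHom, RingHom.map_det] at hdvd
    obtain ⟨v, hv0, hv⟩ := Matrix.exists_mulVec_eq_zero_iff.mpr hroot
    obtain ⟨a, ha⟩ := Function.ne_iff.mp hv0
    have hl : Pi.single a (v a)⁻¹ ⬝ᵥ v = 1 := by rw [single_dotProduct, inv_mul_cancel₀ ha]
    obtain ⟨M', rfl⟩ := exists_eq_mul_linearFactor M hv hl
    rw [Matrix.det_mul, det_linearFactor _ hl, mul_dvd_mul_iff_right (X_sub_C_ne_zero _)] at hM
    set D : Matrix ι ι K[X] := linearFactor (μ 0) v (Pi.single a (v a)⁻¹)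
    let F (k : ℕ) : Submodule K (ι → Y) := Submodule.pi Set.univ fun _ => W k
    have hM' : r ≤ finrank K (F 1 ⊓ LinearMap.ker (polyAct T M') : Submodule K (ι → Y)) :=
      ih (fun k => W (k + 1)) (fun k => μ (k + 1)) (fun k hk => hlt (k + 1) (by omega))
        (fun k hk => hT (k + 1) (by omega)) M' hM
    have hgain : finrank K (F 1) <
        finrank K (F 0 ⊓ (F 1).comap (polyAct T D) : Submodule K (ι → Y)) :=
      finrank_pi_lt_finrank_inf_comap_polyAct (hlt 0 r.succ_pos) (hT 0 r.succ_pos) hl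
    have hdim := finrank_add_le_finrank_inf_comap (polyAct T D)
      (F := F 0 ⊓ (F 1).comap (polyAct T D)) (fun _ hx => hx.2)
      (inf_le_left : F 1 ⊓ LinearMap.ker (polyAct T M') ≤ F 1)
    have hle : F 0 ⊓ (F 1).comap (polyAct T D) ⊓
        (F 1 ⊓ LinearMap.ker (polyAct T M')).comap (polyAct T D) ≤
          F 0 ⊓ LinearMap.ker (polyAct T (M' * D)) :=
      fun x hx => ⟨hx.1.1, (polyAct_mul T M' D x).trans hx.2.2⟩
    have := Submodule.finrank_mono hle
    change r + 1 ≤ finrank K (F 0 ⊓ LinearMap.ker (polyAct T (M' * D)) : Submodule K (ι → Y))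
    omega

/-- The functions on `Fin r` that vanish on the first `k` indices. -/
def tailSpace (K : Type*) [Field K] (r k : ℕ) : Submodule K (Fin r → K) where
  carrier := {y | ∀ i : Fin r, (i : ℕ) < k → y i = 0}
  add_mem' hx hy i hi := by simp [hx i hi, hy i hi]
  zero_mem' _ _ := rfl
  smul_mem' a x hx i hi := by simp [hx i hi]

theorem tailSpace_succ_lt {r k : ℕ} (hk : k < r) : tailSpace K r (k + 1) < tailSpace K r k := by
  refine SetLike.lt_iff_le_and_exists.mpr ⟨fun y hy i hi => hy i (by omega),
    Pi.single ⟨k, hk⟩ 1, fun i hi => Pi.single_eq_of_ne (fun h => by simp [h] at hi) _, fun h => ?_⟩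
  simpa using h ⟨k, hk⟩ (by simp)

theorem vecMul_sub_smul_mem_tailSpace {r : ℕ} {B : Matrix (Fin r) (Fin r) K}
    (hB : B.IsUpperTriangular) (k : Fin r) {y : Fin r → K} (hy : y ∈ tailSpace K r k) :
    y ᵥ* B - B k k • y ∈ tailSpace K r (k + 1) := by
  intro i hi
  have hdiag : (y ᵥ* B) i = y i * B i i := by
    refine Fintype.sum_eq_single i fun l hl => ?_
    rcases lt_or_gt_of_ne hl with hlt | hlt
    · rw [hy l (by have := Fin.lt_def.mp hlt; omega), zero_mul]
    · exact mul_eq_zero_of_right _ (hB hlt)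
  rw [Pi.sub_apply, Pi.smul_apply, hdiag, smul_eq_mul]
  rcases (Nat.lt_succ_iff.mp hi).lt_or_eq with hlt | heq
  · rw [hy i hlt]
    ring
  · rw [Fin.ext heq]
    ring

theorem le_finrank_ker_polyAct_vecMulLinear {r : ℕ} {B : Matrix (Fin r) (Fin r) K}
    (hB : B.IsUpperTriangular) (M : Matrix ι ι K[X]) (hM : ∏ i, (X - C (B i i)) ∣ M.det) :
    r ≤ finrank K (LinearMap.ker (polyAct (Matrix.vecMulLinear B) M)) := by
  let μ (k : ℕ) : K := if hk : k < r then B ⟨k, hk⟩ ⟨k, hk⟩ else 0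
  have hprod : ∏ k ∈ Finset.range r, (X - C (μ k)) = ∏ i, (X - C (B i i)) := by
    rw [← Fin.prod_univ_eq_prod_range (fun k => X - C (μ k))]
    exact Fintype.prod_congr _ _ fun i => by simp [μ]
  refine (le_finrank_pi_inf_ker_polyAct (Matrix.vecMulLinear B) r (tailSpace K r) μ
    (fun k => tailSpace_succ_lt) (fun k hk y hy => ?_) M (hprod ▸ hM)).trans
    (Submodule.finrank_mono inf_le_right)
  simpa [μ, hk] using vecMul_sub_smul_mem_tailSpace hB ⟨k, hk⟩ hy

theorem vecMulLinear_pow {r : ℕ} (B : Matrix (Fin r) (Fin r) K) (j : ℕ) :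
    Matrix.vecMulLinear B ^ j = Matrix.vecMulLinear (B ^ j) := by
  induction j with
  | zero => ext; simp
  | succ j ih =>
    refine LinearMap.ext fun y => ?_
    rw [pow_succ', End.mul_apply, ih, Matrix.vecMulLinear_apply, Matrix.vecMulLinear_apply,
      Matrix.vecMul_vecMul, ← pow_succ, Matrix.vecMulLinear_apply]

end PolyAct

/-! ### Lower bound for perturbations -/

theorem svSmallest_le {ι : Type*} [Fintype ι] [DecidableEq ι] {M : Matrix ι ι ℂ} {k : ℕ} {c : ℝ}
    (hk : 0 < k) (hkι : k ≤ Fintype.card ι) (W : Submodule ℂ (ι → ℂ)) (hW : k ≤ finrank ℂ W)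
    (h : ∀ x ∈ W, ‖WithLp.toLp 2 (M *ᵥ x)‖ ≤ c * ‖WithLp.toLp 2 x‖) : svSmallest k M ≤ c := by
  let e : (ι → ℂ) ≃ₗ[ℂ] EuclideanSpace ℂ ι := (WithLp.linearEquiv 2 ℂ (ι → ℂ)).symm
  have hfr : finrank ℂ (W.map (e : (ι → ℂ) →ₗ[ℂ] EuclideanSpace ℂ ι)) = finrank ℂ W :=
    LinearEquiv.finrank_map_eq e W
  refine singularValues_le_of_forall_mem _ (W := W.map (e : (ι → ℂ) →ₗ[ℂ] EuclideanSpace ℂ ι))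
    ?_ ?_ ?_
  · rw [finrank_euclideanSpace]
    omega
  · rw [finrank_euclideanSpace, hfr]
    omega
  · rintro _ ⟨x, hx, rfl⟩
    exact h x hx

/-- The block of index `l` of a vector that is partitioned into blocks. -/
def block {κ α : Type*} (x : κ × α → ℂ) (l : κ) : α → ℂ := fun a => x (l, a)

theorem norm_sq_toLp_eq_sum_block {κ α : Type*} [Fintype κ] [Fintype α] (x : κ × α → ℂ) :
    ‖WithLp.toLp 2 x‖ ^ 2 = ∑ l, ‖WithLp.toLp 2 (block x l)‖ ^ 2 := by
  simp only [EuclideanSpace.norm_sq_eq, Fintype.sum_prod_type]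
  rfl

section LowerBound

variable {n m r : ℕ}

theorem norm_toLp_mulVec_le (D : Matrix (Fin n) (Fin n) ℂ) (x : Fin n → ℂ) :
    ‖WithLp.toLp 2 (D *ᵥ x)‖ ≤ specNorm D * ‖WithLp.toLp 2 x‖ :=
  (Matrix.toEuclideanCLM (𝕜 := ℂ) D).le_opNorm (WithLp.toLp 2 x)

theorem specNorm_nonneg (D : Matrix (Fin n) (Fin n) ℂ) : 0 ≤ specNorm D := norm_nonneg _

theorem norm_toLp_vec_mul_le (D : Matrix (Fin n) (Fin n) ℂ) (V : Matrix (Fin n) (Fin r) ℂ) :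
    ‖WithLp.toLp 2 (D * V).vec‖ ≤ specNorm D * ‖WithLp.toLp 2 V.vec‖ := by
  refine le_of_sq_le_sq ?_ (mul_nonneg (specNorm_nonneg D) (norm_nonneg _))
  rw [mul_pow, norm_sq_toLp_eq_sum_block, norm_sq_toLp_eq_sum_block, Finset.mul_sum]
  refine Finset.sum_le_sum fun i _ => ?_
  rw [← mul_pow]
  exact pow_le_pow_left₀ (norm_nonneg _) (norm_toLp_mulVec_le D (V.col i)) 2

theorem blockQ_mulVec_vec (A : Fin (m + 1) → Matrix (Fin n) (Fin n) ℂ) (μ : Fin r → ℂ)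
    (Γ : Params r) (V : Matrix (Fin n) (Fin r) ℂ) :
    blockQ A μ Γ *ᵥ V.vec = (∑ j : Fin (m + 1), A j * V * triC μ Γ ^ (j : ℕ)).vec := by
  rw [← kronQ_eq_blockQ, kronQ, Matrix.sum_mulVec, Matrix.vec_sum]
  refine Fintype.sum_congr _ _ fun j => ?_
  rw [Matrix.kronecker_mulVec_vec, Matrix.transpose_transpose]

/-- The matrix polynomial `P(λ) + Δ`. -/
def pertMat (A : Fin (m + 1) → Matrix (Fin n) (Fin n) ℂ) (Δ : Matrix (Fin n) (Fin n) ℂ) :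
    Matrix (Fin n) (Fin n) ℂ[X] :=
  (∑ j : Fin (m + 1), (X : ℂ[X]) ^ (j : ℕ) • (A j).map C) + Δ.map C

theorem polyAct_pertMat (A : Fin (m + 1) → Matrix (Fin n) (Fin n) ℂ)
    (Δ : Matrix (Fin n) (Fin n) ℂ) (B : Matrix (Fin r) (Fin r) ℂ) (V : Fin n → Fin r → ℂ) :
    Matrix.of (polyAct (Matrix.vecMulLinear B) (pertMat A Δ) V) =
      (∑ j : Fin (m + 1), A j * Matrix.of V * B ^ (j : ℕ)) + Δ * Matrix.of V := by
  ext a i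
  rw [Matrix.of_apply, polyAct_apply]
  simp only [pertMat, Matrix.add_apply, Matrix.sum_apply, Matrix.smul_apply, Matrix.map_apply,
    smul_eq_mul, map_add, map_sum, map_mul, map_pow, aeval_X, aeval_C, LinearMap.add_apply,
    LinearMap.sum_apply, End.mul_apply, Module.algebraMap_end_apply, vecMulLinear_pow,
    Finset.sum_add_distrib, Pi.add_apply, Finset.sum_apply, Pi.smul_apply]
  congr 1
  rw [Finset.sum_comm]
  refine Fintype.sum_congr _ _ fun j => ?_
  rw [Matrix.mul_assoc, Matrix.mul_apply]
  refine Fintype.sum_congr _ _ fun b => ?_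
  rw [map_smul]
  rfl

theorem isUpperTriangular_triC (μ : Fin r → ℂ) (Γ : Params r) : (triC μ Γ).IsUpperTriangular := by
  intro l i (h : i < l)
  rw [triC, Matrix.of_apply, if_neg h.ne', gam_eq_zero Γ h.asymm]

theorem triC_apply_self (μ : Fin r → ℂ) (Γ : Params r) (i : Fin r) : triC μ Γ i i = μ i := by
  rw [triC, Matrix.of_apply, if_pos rfl]

theorem objective_le_specNorm (hn : 0 < n) (hr : 0 < r)
    (A : Fin (m + 1) → Matrix (Fin n) (Fin n) ℂ) (Δ : Matrix (Fin n) (Fin n) ℂ) (μ : Fin r → ℂ)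
    (Γ : Params r) (h : ∏ i, (X - C (μ i)) ∣ pertDet A Δ) : objective A μ Γ ≤ specNorm Δ := by
  let e : (Fin n → Fin r → ℂ) →ₗ[ℂ] (Fin r × Fin n → ℂ) :=
    { toFun := fun V => (Matrix.of V).vec
      map_add' := fun _ _ => rfl
      map_smul' := fun _ _ => rfl }
  have he : Function.Injective e := fun V W hVW => Matrix.of.injective (Matrix.vec_inj.mp hVW)
  set N := LinearMap.ker (polyAct (Matrix.vecMulLinear (triC μ Γ)) (pertMat A Δ))
  have hN : r ≤ finrank ℂ (N.map e) := by
    rw [← (N.equivMapOfInjective e he).finrank_eq]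
    exact le_finrank_ker_polyAct_vecMulLinear (isUpperTriangular_triC μ Γ) _
      (by simp only [triC_apply_self]; exact h)
  refine svSmallest_le hr (by simpa using Nat.le_mul_of_pos_right r hn) (N.map e) hN ?_
  rintro _ ⟨V, hV, rfl⟩
  have hker : (∑ j : Fin (m + 1), A j * Matrix.of V * triC μ Γ ^ (j : ℕ)) + Δ * Matrix.of V =
      0 := by
    rw [← polyAct_pertMat, show polyAct _ (pertMat A Δ) V = 0 from hV, Matrix.of_zero]
  change ‖WithLp.toLp 2 (blockQ A μ Γ *ᵥ (Matrix.of V).vec)‖ ≤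
    _ * ‖WithLp.toLp 2 (Matrix.of V).vec‖
  rw [blockQ_mulVec_vec, eq_neg_of_add_eq_zero_left hker, Matrix.vec_neg, WithLp.toLp_neg, norm_neg]
  exact norm_toLp_vec_mul_le Δ (Matrix.of V)

end LowerBound

/-! ### Differences of powers -/

section PowDiff

variable {K R : Type*} [CommRing K] [Ring R] [Algebra K R]

/-- The sum of `Xᵃ * E * Yᵇ` over `a + b = j - 1`, so that `Xʲ - Yʲ = powDiff X Y (X - Y) j`. -/
def powDiff (X Y E : R) : ℕ → R
  | 0 => 0
  | j + 1 => powDiff X Y E j * Y + X ^ j * E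

theorem pow_add_smul_eq (t : K) (Y E : R) (j : ℕ) :
    (Y + t • E) ^ j = Y ^ j + t • powDiff (Y + t • E) Y E j := by
  induction j with
  | zero => simp [powDiff]
  | succ j ih =>
    calc (Y + t • E) ^ (j + 1)
        = (Y + t • E) ^ j * Y + t • ((Y + t • E) ^ j * E) := by
          rw [pow_succ, mul_add, mul_smul_comm]
      _ = Y ^ (j + 1) + t • powDiff (Y + t • E) Y E (j + 1) := by
          rw [powDiff, smul_add, ← add_assoc, ← smul_mul_assoc t (powDiff _ _ _ _),
            pow_succ Y, ← add_mul, ← ih]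

theorem powDiff_succ' (X Y E : R) (j : ℕ) :
    powDiff X Y E (j + 1) = X * powDiff X Y E j + E * Y ^ j := by
  induction j with
  | zero => simp [powDiff]
  | succ j ih =>
    conv_rhs => rw [powDiff]
    rw [powDiff, ih, pow_succ Y, pow_succ' X]
    noncomm_ring

theorem powDiff_mul_sub_mul_powDiff (X Y E : R) (j : ℕ) :
    powDiff X Y E j * Y - X * powDiff X Y E j = E * Y ^ j - X ^ j * E :=
  sub_eq_sub_iff_add_eq_add.mpr ((powDiff_succ' X Y E j).trans (add_comm _ _))

theorem powDiff_mul_left (X Y E : R) (j : ℕ) : powDiff X Y (X * E) j = X * powDiff X Y E j := by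
  induction j with
  | zero => simp [powDiff]
  | succ j ih =>
    rw [powDiff, powDiff, ih, mul_add, mul_assoc, ← mul_assoc (X ^ j), ← mul_assoc X (X ^ j),
      ← pow_succ, ← pow_succ']

theorem continuous_powDiff {α : Type*} [TopologicalSpace α] [TopologicalSpace R]
    [IsTopologicalRing R] {X : α → R} (hX : Continuous X) (Y E : R) (j : ℕ) :
    Continuous fun t => powDiff (X t) Y E j := by
  induction j with
  | zero => exact continuous_const
  | succ j ih =>
    simp only [powDiff]
    fun_prop

theorem trace_mul_powDiff {ι : Type*} [Fintype ι] [DecidableEq ι] (X Y M E : Matrix ι ι K)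
    (j : ℕ) : (M * powDiff X Y E j).trace = (powDiff Y X M j * E).trace := by
  induction j generalizing M with
  | zero => simp [powDiff]
  | succ j ih =>
    rw [powDiff, powDiff_succ', mul_add, add_mul, Matrix.trace_add, Matrix.trace_add, ← mul_assoc,
      Matrix.trace_mul_comm _ Y, ← mul_assoc, ← mul_assoc, ih, powDiff_mul_left]

end PowDiff

/-! ### Commutators of triangular matrices -/

theorem isUpperTriangular_mul_apply_self {R ι : Type*} [NonUnitalNonAssocSemiring R] [Fintype ι]
    [LinearOrder ι] {M N : Matrix ι ι R} (hM : M.IsUpperTriangular) (hN : N.IsUpperTriangular)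
    (i : ι) : (M * N) i i = M i i * N i i := by
  rw [Matrix.mul_apply]
  refine Fintype.sum_eq_single i fun l hl => ?_
  rcases lt_or_gt_of_ne hl with h | h
  · exact mul_eq_zero_of_left (hM h) _
  · exact mul_eq_zero_of_right _ (hN h)

theorem commutator_eq_zero_of_isHermitian {R ι : Type*} [CommRing R] [StarRing R] [Fintype ι]
    [LinearOrder ι] {M N : Matrix ι ι R} (hM : M.IsUpperTriangular) (hN : N.IsUpperTriangular)
    (h : (M * N - N * M).IsHermitian) : M * N - N * M = 0 := by
  have hupper : (M * N - N * M).IsUpperTriangular := (hM.mul hN).sub (hN.mul hM)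
  ext i l
  rcases lt_trichotomy l i with hlt | rfl | hlt
  · exact hupper hlt
  · rw [Matrix.sub_apply, isUpperTriangular_mul_apply_self hM hN,
      isUpperTriangular_mul_apply_self hN hM, mul_comm, sub_self, Matrix.zero_apply]
  · rw [← h.apply, hupper hlt, star_zero, Matrix.zero_apply]

/-! ### First-order optimality -/

section

variable {ι : Type*} [Fintype ι] [DecidableEq ι]

/-- `u` and `v` form a consistent pair of left and right singular vectors of `M` for `σ`. -/
structure IsSingularPair (M : Matrix ι ι ℂ) (σ : ℝ) (u v : ι → ℂ) : Prop where
  mulVec_right : M *ᵥ v = (σ : ℂ) • u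
  star_left_vecMul : star u ᵥ* M = (σ : ℂ) • star v

theorem IsSingularPair.toEuclideanLin_right {M : Matrix ι ι ℂ} {σ : ℝ} {u v : ι → ℂ}
    (h : IsSingularPair M σ u v) :
    Matrix.toEuclideanLin M (WithLp.toLp 2 v) = (σ : ℂ) • WithLp.toLp 2 u :=
  congrArg (WithLp.toLp 2) h.mulVec_right

theorem IsSingularPair.adjoint_apply {M : Matrix ι ι ℂ} {σ : ℝ} {u v : ι → ℂ}
    (h : IsSingularPair M σ u v) :
    (Matrix.toEuclideanLin M).adjoint (Matrix.toEuclideanLin M (WithLp.toLp 2 v)) =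
      ((σ ^ 2 : ℝ) : ℂ) • WithLp.toLp 2 v := by
  have hu : Mᴴ *ᵥ u = (σ : ℂ) • v := by
    have hstar := congrArg star h.star_left_vecMul
    rw [Matrix.star_vecMul, star_star, star_smul, star_star] at hstar
    simpa using hstar
  have hu' : (Matrix.toEuclideanLin M).adjoint (WithLp.toLp 2 u) = (σ : ℂ) • WithLp.toLp 2 v := by
    rw [← Matrix.toEuclideanLin_conjTranspose_eq_adjoint]
    exact congrArg (WithLp.toLp 2) hu
  rw [h.toEuclideanLin_right, map_smul, hu', smul_smul, sq, Complex.ofReal_mul]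

theorem svSmallest_lt_sv {M : Matrix ι ι ℂ} {k : ℕ} (hk : 0 < k) (hkι : k ≤ Fintype.card ι)
    (h : svMultiplicity M (svSmallest k M) = 1) {j : ℕ} (hj : j < Fintype.card ι - k) :
    svSmallest k M < sv M j := by
  refine (LinearMap.singularValues_antitone _ hj.le).lt_of_ne fun he => hj.ne ?_
  obtain ⟨a, ha⟩ := Set.ncard_eq_one.mp h
  have hj' : j ∈ ({a} : Set ℕ) := ha ▸ ⟨by omega, he.symm⟩
  have hk' : Fintype.card ι - k ∈ ({a} : Set ℕ) := ha ▸ ⟨by omega, rfl⟩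
  exact hj'.trans hk'.symm

theorem continuous_toEuclideanLin_apply {M : ℝ → Matrix ι ι ℂ} (hM : Continuous M) :
    Continuous fun p : ℝ × EuclideanSpace ℂ ι => Matrix.toEuclideanLin (M p.1) p.2 :=
  (PiLp.continuous_toLp 2 _).comp <|
    (hM.comp continuous_fst).matrix_mulVec ((PiLp.continuous_ofLp 2 _).comp continuous_snd)

theorem exists_svSmallest_lt_svSmallest_add_smul {M : Matrix ι ι ℂ} {D : ℝ → Matrix ι ι ℂ}
    (hD : Continuous D) {k : ℕ} (hk : 0 < k) (hkι : k ≤ Fintype.card ι) {u v : ι → ℂ}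
    (huv : IsSingularPair M (svSmallest k M) u v) (hmul : svMultiplicity M (svSmallest k M) = 1)
    (hσ : 0 < svSmallest k M) (hslope : 0 < (star u ⬝ᵥ (D 0 *ᵥ v)).re) :
    ∃ t : ℝ, svSmallest k M < svSmallest k (M + (t : ℂ) • D t) := by
  have hinner : inner ℂ (Matrix.toEuclideanLin M (WithLp.toLp 2 v))
      (Matrix.toEuclideanLin (D 0) (WithLp.toLp 2 v)) =
        (svSmallest k M : ℂ) * (star u ⬝ᵥ (D 0 *ᵥ v)) := by
    rw [huv.toEuclideanLin_right, inner_smul_left, Complex.conj_ofReal, dotProduct_comm]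
    rfl
  have hpos : 0 < RCLike.re (inner ℂ (Matrix.toEuclideanLin M (WithLp.toLp 2 v))
      (Matrix.toEuclideanLin (D 0) (WithLp.toLp 2 v))) := by
    rw [hinner, RCLike.re_eq_complex_re, Complex.re_ofReal_mul]
    exact mul_pos hσ hslope
  obtain ⟨t, ht⟩ := exists_lt_singularValues_add_smul (Matrix.toEuclideanLin M)
    (D := fun t => Matrix.toEuclideanLin (D t)) (continuous_toEuclideanLin_apply hD)
    (k := Fintype.card ι - k) (by rw [finrank_euclideanSpace]; omega) huv.adjoint_apply
    (fun j hj => svSmallest_lt_sv hk hkι hmul hj) hpos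
  refine ⟨t, ?_⟩
  rw [svSmallest, svSmallest, sv, sv, map_add, map_smul]
  exact ht

end

section

variable {n m r : ℕ}

theorem triC_add_smul (μ : Fin r → ℂ) (Γ Θ : Params r) (t : ℂ) :
    triC μ (Γ + t • Θ) = triC μ Γ + t • triC 0 Θ := by
  ext l i
  simp only [triC, Matrix.add_apply, Matrix.of_apply, Matrix.smul_apply, gam]
  split_ifs <;> simp

theorem triC_zero_smul (Θ : Params r) (c : ℂ) : triC 0 (c • Θ) = c • triC 0 Θ := by
  ext l i
  simp only [triC, Matrix.of_apply, Matrix.smul_apply, gam]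
  split_ifs <;> simp

theorem triC_zero_single {i l : Fin r} (h : l < i) :
    triC 0 (Pi.single ⟨(i, l), h⟩ 1) = Matrix.single l i (1 : ℂ) := by
  ext l' i'
  simp only [triC, gam, Matrix.of_apply, Matrix.single_apply, Pi.single_apply, Pi.zero_apply]
  grind

theorem continuous_triC (μ : Fin r → ℂ) : Continuous fun Γ : Params r => triC μ Γ := by
  refine continuous_matrix fun l i => ?_
  simp only [triC, Matrix.of_apply, gam]
  split_ifs <;> fun_prop

theorem continuous_kronecker_right {p : Type*} (B : Matrix (Fin n) (Fin n) ℂ) :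
    Continuous fun M : Matrix p p ℂ => M ⊗ₖ B :=
  continuous_matrix fun x y => (continuous_id.matrix_elem x.1 y.1).mul continuous_const

theorem continuous_blockQ (A : Fin (m + 1) → Matrix (Fin n) (Fin n) ℂ) (μ : Fin r → ℂ) :
    Continuous fun Γ : Params r => blockQ A μ Γ := by
  simp only [← kronQ_eq_blockQ, kronQ]
  refine continuous_finsetSum _ fun j _ => (continuous_kronecker_right (A j)).comp ?_
  exact Continuous.matrix_transpose ((continuous_triC μ).pow j)

/-- The difference quotient of `Q(μ, Γ + t Θ, P)` in `t`; at `t = 0` it is the derivative. -/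
def slopeQ (A : Fin (m + 1) → Matrix (Fin n) (Fin n) ℂ) (μ : Fin r → ℂ) (Γ Θ : Params r) (t : ℂ) :
    Matrix (Fin r × Fin n) (Fin r × Fin n) ℂ :=
  ∑ j : Fin (m + 1), (powDiff (triC μ (Γ + t • Θ)) (triC μ Γ) (triC 0 Θ) j)ᵀ ⊗ₖ A j

theorem blockQ_add_smul (A : Fin (m + 1) → Matrix (Fin n) (Fin n) ℂ) (μ : Fin r → ℂ)
    (Γ Θ : Params r) (t : ℂ) :
    blockQ A μ (Γ + t • Θ) = blockQ A μ Γ + t • slopeQ A μ Γ Θ t := by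
  rw [← kronQ_eq_blockQ, ← kronQ_eq_blockQ, kronQ, kronQ, slopeQ, Finset.smul_sum,
    ← Finset.sum_add_distrib]
  refine Fintype.sum_congr _ _ fun j => ?_
  rw [triC_add_smul, pow_add_smul_eq, Matrix.transpose_add, Matrix.transpose_smul,
    Matrix.add_kronecker, Matrix.smul_kronecker]

theorem continuous_slopeQ (A : Fin (m + 1) → Matrix (Fin n) (Fin n) ℂ) (μ : Fin r → ℂ)
    (Γ Θ : Params r) : Continuous (slopeQ A μ Γ Θ) := by
  refine continuous_finsetSum _ fun j _ => (continuous_kronecker_right (A j)).comp ?_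
  refine Continuous.matrix_transpose (continuous_powDiff ?_ _ _ _)
  exact (continuous_triC μ).comp (by fun_prop)

theorem star_vec_dotProduct_slopeQ_mulVec_vec (A : Fin (m + 1) → Matrix (Fin n) (Fin n) ℂ)
    (μ : Fin r → ℂ) (Γ Θ : Params r) (U V : Matrix (Fin n) (Fin r) ℂ) :
    star U.vec ⬝ᵥ (slopeQ A μ Γ Θ 0 *ᵥ V.vec) =
      ((∑ j : Fin (m + 1), powDiff (triC μ Γ) (triC μ Γ) (Uᴴ * A j * V) j) * triC 0 Θ).trace := by
  rw [slopeQ, Matrix.sum_mulVec, dotProduct_sum, Finset.sum_mul, Matrix.trace_sum]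
  refine Fintype.sum_congr _ _ fun j => ?_
  rw [Matrix.kronecker_mulVec_vec, Matrix.transpose_transpose, Matrix.star_vec_dotProduct_vec,
    zero_smul, add_zero, ← trace_mul_powDiff]
  simp only [Matrix.mul_assoc]

theorem re_star_dotProduct_slopeQ_mulVec_nonpos (hn : 0 < n) (hr : 0 < r)
    {A : Fin (m + 1) → Matrix (Fin n) (Fin n) ℂ} {μ : Fin r → ℂ} {Γ : Params r}
    (hopt : IsOptimalParams A μ Γ) (hmul : MultiplicityAssumption A μ Γ)
    (hσ : 0 < objective A μ Γ) {u v : Fin r × Fin n → ℂ}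
    (huv : IsSingularPair (blockQ A μ Γ) (objective A μ Γ) u v) (Θ : Params r) :
    (star u ⬝ᵥ (slopeQ A μ Γ Θ 0 *ᵥ v)).re ≤ 0 := by
  by_contra! hz
  have hcard : r ≤ Fintype.card (Fin r × Fin n) := by
    simpa using Nat.le_mul_of_pos_right r hn
  have hslope : Continuous fun t : ℝ => slopeQ A μ Γ Θ t :=
    (continuous_slopeQ A μ Γ Θ).comp Complex.continuous_ofReal
  obtain ⟨t, ht⟩ := exists_svSmallest_lt_svSmallest_add_smul hslope hr hcard huv hmul hσ
    (by simpa only [Complex.ofReal_zero] using hz)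
  rw [← blockQ_add_smul] at ht
  exact ht.not_ge (hopt _)

theorem star_vec_dotProduct_slopeQ_mulVec_vec_eq_zero (hn : 0 < n) (hr : 0 < r)
    {A : Fin (m + 1) → Matrix (Fin n) (Fin n) ℂ} {μ : Fin r → ℂ} {Γ : Params r}
    (hopt : IsOptimalParams A μ Γ) (hmul : MultiplicityAssumption A μ Γ)
    (hσ : 0 < objective A μ Γ) {U V : Matrix (Fin n) (Fin r) ℂ}
    (hUV : IsSingularPair (blockQ A μ Γ) (objective A μ Γ) U.vec V.vec) (Θ : Params r) :
    star U.vec ⬝ᵥ (slopeQ A μ Γ Θ 0 *ᵥ V.vec) = 0 := by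
  -- Testing the direction `conj z • Θ`, where `z` is the derivative along `Θ`, gives `‖z‖² ≤ 0`.
  set z := star U.vec ⬝ᵥ (slopeQ A μ Γ Θ 0 *ᵥ V.vec) with hz
  have hconj : star U.vec ⬝ᵥ (slopeQ A μ Γ (starRingEnd ℂ z • Θ) 0 *ᵥ V.vec) =
      (Complex.normSq z : ℂ) := by
    rw [Complex.normSq_eq_conj_mul_self, hz, star_vec_dotProduct_slopeQ_mulVec_vec,
      star_vec_dotProduct_slopeQ_mulVec_vec, triC_zero_smul, Matrix.mul_smul, Matrix.trace_smul,
      smul_eq_mul]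
  have hle := re_star_dotProduct_slopeQ_mulVec_nonpos hn hr hopt hmul hσ hUV (starRingEnd ℂ z • Θ)
  rw [hconj, Complex.ofReal_re] at hle
  exact Complex.normSq_eq_zero.mp (hle.antisymm (Complex.normSq_nonneg z))

theorem sum_mul_triC_pow_of_isSingularPair {A : Fin (m + 1) → Matrix (Fin n) (Fin n) ℂ}
    {μ : Fin r → ℂ} {Γ : Params r} {σ : ℝ} {U V : Matrix (Fin n) (Fin r) ℂ}
    (h : IsSingularPair (blockQ A μ Γ) σ U.vec V.vec) :
    ∑ j : Fin (m + 1), A j * V * triC μ Γ ^ (j : ℕ) = (σ : ℂ) • U := by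
  have hvec := h.mulVec_right
  rwa [blockQ_mulVec_vec, ← Matrix.vec_smul, Matrix.vec_inj] at hvec

theorem sum_triC_pow_mul_of_isSingularPair {A : Fin (m + 1) → Matrix (Fin n) (Fin n) ℂ}
    {μ : Fin r → ℂ} {Γ : Params r} {σ : ℝ} {U V : Matrix (Fin n) (Fin r) ℂ}
    (h : IsSingularPair (blockQ A μ Γ) σ U.vec V.vec) :
    ∑ j : Fin (m + 1), triC μ Γ ^ (j : ℕ) * (Uᴴ * A j) = (σ : ℂ) • Vᴴ := by
  have hvec := h.star_left_vecMul
  rw [← kronQ_eq_blockQ, kronQ, Matrix.star_vec, Matrix.star_vec, Matrix.vecMul_sum,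
    ← Matrix.vec_smul] at hvec
  simp only [Matrix.vec_vecMul_kronecker] at hvec
  rw [← Matrix.vec_sum, Matrix.vec_inj] at hvec
  have htrans := congrArg Matrix.transpose hvec
  rw [Matrix.transpose_sum, Matrix.transpose_smul] at htrans
  simp only [Matrix.transpose_mul, Matrix.transpose_transpose] at htrans
  exact htrans

/-- Stationarity says that a certain `B` is upper triangular, and `[B, C(μ, Γ)]` is a positive
multiple of the difference of the two Gram matrices; a Hermitian commutator of triangular matrices
vanishes. -/
theorem conjTranspose_mul_self_eq_of_isOptimalParams (hn : 0 < n) (hr : 0 < r)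
    {A : Fin (m + 1) → Matrix (Fin n) (Fin n) ℂ} {μ : Fin r → ℂ} {Γ : Params r}
    (hopt : IsOptimalParams A μ Γ) (hmul : MultiplicityAssumption A μ Γ)
    (hσ : 0 < objective A μ Γ) {U V : Matrix (Fin n) (Fin r) ℂ}
    (hUV : IsSingularPair (blockQ A μ Γ) (objective A μ Γ) U.vec V.vec) : Uᴴ * U = Vᴴ * V := by
  set Y := triC μ Γ with hY
  set B := ∑ j : Fin (m + 1), powDiff Y Y (Uᴴ * A j * V) j with hB
  have hBupper : B.IsUpperTriangular := by
    intro i l (hl : l < i)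
    have hstat := star_vec_dotProduct_slopeQ_mulVec_vec_eq_zero hn hr hopt hmul hσ hUV
      (Pi.single ⟨(i, l), hl⟩ 1)
    rw [star_vec_dotProduct_slopeQ_mulVec_vec, triC_zero_single, ← hY, ← hB,
      Matrix.trace_mul_single] at hstat
    simpa using hstat
  have hcomm : B * Y - Y * B = (objective A μ Γ : ℂ) • (Uᴴ * U - Vᴴ * V) :=
    calc B * Y - Y * B
        = ∑ j : Fin (m + 1), (Uᴴ * A j * V * Y ^ (j : ℕ) - Y ^ (j : ℕ) * (Uᴴ * A j * V)) := by
          simp only [hB, Finset.sum_mul, Finset.mul_sum, ← Finset.sum_sub_distrib,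
            powDiff_mul_sub_mul_powDiff]
      _ = Uᴴ * (∑ j : Fin (m + 1), A j * V * Y ^ (j : ℕ)) -
            (∑ j : Fin (m + 1), Y ^ (j : ℕ) * (Uᴴ * A j)) * V := by
          simp only [Finset.sum_sub_distrib, Matrix.mul_sum, Matrix.sum_mul, Matrix.mul_assoc]
      _ = (objective A μ Γ : ℂ) • (Uᴴ * U - Vᴴ * V) := by
          rw [sum_mul_triC_pow_of_isSingularPair hUV, sum_triC_pow_mul_of_isSingularPair hUV,
            Matrix.mul_smul, Matrix.smul_mul, smul_sub]
  have hherm : (B * Y - Y * B).IsHermitian := by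
    rw [hcomm]
    exact ((Matrix.isHermitian_conjTranspose_mul_self U).sub
      (Matrix.isHermitian_conjTranspose_mul_self V)).smul (Complex.conj_ofReal _)
  have hzero := commutator_eq_zero_of_isHermitian hBupper (isUpperTriangular_triC μ Γ) hherm
  rw [hcomm, smul_eq_zero] at hzero
  exact sub_eq_zero.mp (hzero.resolve_left (Complex.ofReal_ne_zero.mpr hσ.ne'))

end

/-! ### The optimal perturbation -/

theorem isUnit_of_rank_eq_card {K ι : Type*} [Field K] [Fintype ι] [DecidableEq ι]
    {M : Matrix ι ι K} (h : M.rank = Fintype.card ι) : IsUnit M := by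
  rw [← Matrix.linearIndependent_cols_iff_isUnit, linearIndependent_iff_card_eq_finrank_span,
    ← h, Matrix.rank_eq_finrank_span_cols, Set.finrank]

section LeftInverse

variable {n r : ℕ}

/-- The Moore–Penrose inverse `(V* V)⁻¹ V*` of a matrix `V` of full column rank. -/
def leftInv (V : Matrix (Fin n) (Fin r) ℂ) : Matrix (Fin r) (Fin n) ℂ := (Vᴴ * V)⁻¹ * Vᴴ

open scoped ComplexOrder in
theorem leftInv_mul {V : Matrix (Fin n) (Fin r) ℂ} (hV : V.rank = r) : leftInv V * V = 1 := by
  have hunit : IsUnit (Vᴴ * V) := isUnit_of_rank_eq_card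
    (by rw [Matrix.rank_conjTranspose_mul_self, hV, Fintype.card_fin])
  rw [leftInv, Matrix.mul_assoc,
    Matrix.nonsing_inv_mul _ ((Matrix.isUnit_iff_isUnit_det _).mp hunit)]

theorem isStarProjection_mul_leftInv {V : Matrix (Fin n) (Fin r) ℂ} (hV : V.rank = r) :
    IsStarProjection (V * leftInv V) where
  isIdempotentElem := by
    rw [IsIdempotentElem, Matrix.mul_assoc, ← Matrix.mul_assoc (leftInv V), leftInv_mul hV,
      Matrix.one_mul]
  isSelfAdjoint := by
    have hgram : ((Vᴴ * V)⁻¹)ᴴ = (Vᴴ * V)⁻¹ := by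
      rw [Matrix.conjTranspose_nonsing_inv, Matrix.conjTranspose_mul,
        Matrix.conjTranspose_conjTranspose]
    rw [isSelfAdjoint_iff, Matrix.star_eq_conjTranspose, leftInv, Matrix.conjTranspose_mul,
      Matrix.conjTranspose_mul, hgram, Matrix.conjTranspose_conjTranspose, Matrix.mul_assoc]

open scoped Matrix.Norms.L2Operator in
theorem specNorm_eq_l2_opNorm (M : Matrix (Fin n) (Fin n) ℂ) : specNorm M = ‖M‖ := rfl

open scoped Matrix.Norms.L2Operator in
theorem specNorm_le_one_of_isStarProjection {M : Matrix (Fin n) (Fin n) ℂ}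
    (hM : IsStarProjection M) : specNorm M ≤ 1 :=
  IsStarProjection.norm_le M hM

open scoped Matrix.Norms.L2Operator in
theorem specNorm_eq_of_conjTranspose_mul_self_eq {M N : Matrix (Fin n) (Fin n) ℂ}
    (h : Mᴴ * M = Nᴴ * N) : specNorm M = specNorm N := by
  rw [← mul_self_inj (specNorm_nonneg M) (specNorm_nonneg N), specNorm_eq_l2_opNorm,
    specNorm_eq_l2_opNorm, ← Matrix.l2_opNorm_conjTranspose_mul_self, h,
    Matrix.l2_opNorm_conjTranspose_mul_self]

theorem specNorm_mul_leftInv_le_one {U V : Matrix (Fin n) (Fin r) ℂ} (hV : V.rank = r)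
    (h : Uᴴ * U = Vᴴ * V) : specNorm (U * leftInv V) ≤ 1 := by
  rw [specNorm_eq_of_conjTranspose_mul_self_eq (N := V * leftInv V)]
  · exact specNorm_le_one_of_isStarProjection (isStarProjection_mul_leftInv hV)
  · simp only [Matrix.conjTranspose_mul, Matrix.mul_assoc]
    rw [← Matrix.mul_assoc Uᴴ, h, Matrix.mul_assoc]

theorem specNorm_smul (c : ℂ) (M : Matrix (Fin n) (Fin n) ℂ) :
    specNorm (c • M) = ‖c‖ * specNorm M := by
  rw [specNorm, map_smul, norm_smul, specNorm]

end LeftInverse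

section Determinant

variable {R ι κ : Type*} [CommRing R] [Fintype ι] [DecidableEq ι] [Fintype κ] [DecidableEq κ]

theorem det_dvd_det_of_mul_eq {M : Matrix ι ι R} {N V : Matrix ι κ R} {L : Matrix κ ι R}
    {Z : Matrix κ κ R} (hL : L * V = 1) (h : M * V = N * Z) : Z.det ∣ M.det := by
  have hLV (B : Matrix κ ι R) : L * (V * B) = B := by
    rw [← Matrix.mul_assoc, hL, Matrix.one_mul]
  have hM : M = (M - M * V * L + N * L) * (1 + V * ((Z - 1) * L)) := by
    have hfactor : (M - M * V * L + N * L) * (V * ((Z - 1) * L)) = N * Z * L - N * L := by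
      rw [Matrix.add_mul, Matrix.sub_mul, Matrix.mul_assoc (M * V), hLV, Matrix.mul_assoc N, hLV,
        Matrix.mul_assoc M, sub_self, zero_add, Matrix.sub_mul, Matrix.one_mul, Matrix.mul_sub,
        Matrix.mul_assoc]
    rw [Matrix.mul_add, Matrix.mul_one, hfactor, ← h]
    abel
  have hdet : (1 + V * ((Z - 1) * L)).det = Z.det := by
    rw [Matrix.det_one_add_mul_comm, Matrix.mul_assoc, hL, Matrix.mul_one, add_sub_cancel]
  rw [hM, Matrix.det_mul, hdet]
  exact dvd_mul_left _ _

theorem exists_scalar_X_pow_sub_eq_mul_charmatrix (Y : Matrix κ κ R) (j : ℕ) :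
    ∃ N, Matrix.scalar κ (X ^ j : R[X]) - (Y ^ j).map C = N * Y.charmatrix := by
  have hcomm : Commute (Matrix.scalar κ (X : R[X])) (C.mapMatrix Y) :=
    Matrix.scalar_commute _ (fun _ => Commute.all _ _) _
  refine ⟨_, Eq.trans ?_ (hcomm.geom_sum₂_mul j).symm⟩
  rw [← map_pow, ← map_pow]
  rfl

theorem coeff_det_of_natDegree_le {M : Matrix ι ι R[X]} {d : ℕ}
    (h : ∀ i j, (M i j).natDegree ≤ d) :
    M.det.coeff (Fintype.card ι * d) = (M.map fun p => p.coeff d).det := by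
  simp only [Matrix.det_apply, finsetSum_coeff, coeff_smul, Matrix.map_apply]
  refine Fintype.sum_congr _ _ fun τ => congrArg _ ?_
  exact coeff_prod_of_natDegree_le _ _ d fun i _ => h (τ i) i

end Determinant

section Perturbation

variable {n m r : ℕ}

/-- The equation says that `(V, Y)` is an invariant pair of `P + Δ`. -/
theorem charpoly_dvd_pertDet (A : Fin (m + 1) → Matrix (Fin n) (Fin n) ℂ)
    (Δ : Matrix (Fin n) (Fin n) ℂ) {V : Matrix (Fin n) (Fin r) ℂ} {L : Matrix (Fin r) (Fin n) ℂ}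
    (hL : L * V = 1) {Y : Matrix (Fin r) (Fin r) ℂ}
    (h : ∑ j : Fin (m + 1), A j * V * Y ^ (j : ℕ) + Δ * V = 0) : Y.charpoly ∣ pertDet A Δ := by
  choose N hN using exists_scalar_X_pow_sub_eq_mul_charmatrix Y
  refine det_dvd_det_of_mul_eq (M := pertMat A Δ) (V := V.map C) (L := L.map C)
    (N := ∑ j : Fin (m + 1), (A j).map C * V.map C * N j) (Z := Y.charmatrix) ?_ ?_
  · rw [← Matrix.map_mul, hL, Matrix.map_one _ (map_zero C) (map_one C)]
  have hmap : ∑ j : Fin (m + 1), (A j).map C * V.map C * (Y ^ (j : ℕ)).map C =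
      -(Δ.map C * V.map C) := by
    simp only [← Matrix.map_mul]
    rw [← Matrix.map_neg _ (map_neg C), ← eq_neg_of_add_eq_zero_left h]
    exact (map_sum (C : ℂ →+* ℂ[X]).toAddMonoidHom.mapMatrix _ _).symm
  simp only [Matrix.sum_mul, Matrix.mul_assoc _ (N _), ← hN, Matrix.mul_sub,
    Finset.sum_sub_distrib, hmap, sub_neg_eq_add, pertMat, Matrix.add_mul]
  congr 1
  refine Fintype.sum_congr _ _ fun j => ?_
  rw [Matrix.smul_mul, Matrix.scalar_apply, Matrix.smul_eq_mul_diagonal]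

theorem charpoly_triC (μ : Fin r → ℂ) (Γ : Params r) :
    (triC μ Γ).charpoly = ∏ i, (X - C (μ i)) := by
  rw [Matrix.charpoly_of_isUpperTriangular _ (isUpperTriangular_triC μ Γ)]
  simp only [triC_apply_self]

theorem pertDet_ne_zero (hm : 0 < m) (A : Fin (m + 1) → Matrix (Fin n) (Fin n) ℂ)
    (hA : (A (Fin.last m)).rank = n) (Δ : Matrix (Fin n) (Fin n) ℂ) : pertDet A Δ ≠ 0 := by
  have hentry (a b : Fin n) :
      pertMat A Δ a b = ∑ j : Fin (m + 1), X ^ (j : ℕ) * C (A j a b) + C (Δ a b) := by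
    simp [pertMat, Matrix.sum_apply]
  have hdeg (a b : Fin n) : (pertMat A Δ a b).natDegree ≤ m := by
    rw [hentry]
    refine natDegree_add_le_of_degree_le (natDegree_sum_le_of_forall_le _ _ fun j _ => ?_) ?_
    · exact (natDegree_mul_C_le _ _).trans ((natDegree_X_pow_le _).trans (Nat.lt_succ_iff.mp j.2))
    · simp
  have hlead : (pertMat A Δ).map (fun p => p.coeff m) = A (Fin.last m) := by
    ext a b
    rw [Matrix.map_apply, hentry, coeff_add, coeff_C_of_ne_zero hm.ne', add_zero, finsetSum_coeff,
      Fintype.sum_eq_single (Fin.last m)]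
    · simp
    · intro j hj
      rw [coeff_mul_C, coeff_X_pow, if_neg (Fin.val_lt_last hj).ne', zero_mul]
  have hunit : IsUnit (A (Fin.last m)) := isUnit_of_rank_eq_card (by rw [hA, Fintype.card_fin])
  intro h0
  refine ((Matrix.isUnit_iff_isUnit_det _).mp hunit).ne_zero ?_
  rw [← hlead, ← coeff_det_of_natDegree_le hdeg, show (pertMat A Δ).det = 0 from h0, coeff_zero]

end Perturbation

/-! ### Multiplicities -/

section Multiplicity

variable {R : Type*} [CommRing R] [IsDomain R] {p : R[X]} {S : Finset R} {r : ℕ}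

theorem le_sum_rootMultiplicity (hp : p ≠ 0) {μ : Fin r → R} (hμ : ∀ i, μ i ∈ S)
    (h : ∏ i, (X - C (μ i)) ∣ p) : r ≤ ∑ z ∈ S, p.rootMultiplicity z := by
  classical
  set s : Multiset R := Finset.univ.val.map μ with hs
  have hle : s ≤ p.roots := by
    rw [← Multiset.prod_X_sub_C_dvd_iff_le_roots hp, hs, Multiset.map_map]
    exact h
  have hcard : ∑ z ∈ S, s.count z = r := by
    rw [Multiset.sum_count_eq_card (by simpa [hs] using hμ), hs, Multiset.card_map,
      Finset.card_val, Finset.card_univ, Fintype.card_fin]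
  rw [← hcard]
  refine Finset.sum_le_sum fun z _ => ?_
  rw [← count_roots]
  exact Multiset.count_le_of_le z hle

theorem exists_prod_X_sub_C_dvd_of_le_sum_rootMultiplicity (hp : p ≠ 0)
    (h : r ≤ ∑ z ∈ S, p.rootMultiplicity z) :
    ∃ ν : Fin r → R, (∀ i, ν i ∈ S) ∧ ∏ i, (X - C (ν i)) ∣ p := by
  classical
  have hcard : r ≤ Multiset.card (p.roots.filter (· ∈ S)) := by
    rw [← Multiset.sum_count_eq_card (s := S) fun a ha => (Multiset.mem_filter.mp ha).2]
    refine h.trans_eq (Finset.sum_congr rfl fun z hz => ?_)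
    rw [Multiset.count_filter_of_pos hz, count_roots]
  obtain ⟨t, hts, rfl⟩ : ∃ t ≤ p.roots.filter (· ∈ S), Multiset.card t = r := by
    simp only [← Multiset.mem_powersetCard, ← Multiset.card_pos_iff_exists_mem,
      Multiset.card_powersetCard, Nat.choose_pos hcard]
  obtain ⟨l, rfl⟩ := Quot.exists_rep t
  refine ⟨fun i => l[i.1], fun i => ?_, ?_⟩
  · exact (Multiset.mem_filter.mp (Multiset.mem_of_le hts (List.getElem_mem i.2))).2
  · change ∏ i : Fin l.length, (X - C l[i.1]) ∣ p
    rw [Fin.prod_univ_fun_getElem l fun a => X - C a]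
    exact (Multiset.prod_X_sub_C_dvd_iff_le_roots hp l).mpr (hts.trans (Multiset.filter_le _ _))

end Multiplicity

/-! ### The two bounds for `τᵣ` -/

section Bounds

variable {n m r : ℕ}

theorem iInf_innerSup_le_tau (hm : 0 < m) (hn : 0 < n) (hr : 0 < r)
    (A : Fin (m + 1) → Matrix (Fin n) (Fin n) ℂ) (hA : (A (Fin.last m)).rank = n)
    (S : Finset ℂ) : ⨅ ν ∈ tuples S r, innerSup A ν ≤ tau A S r := by
  refine le_iInf₂ fun Δ hΔ => ?_
  obtain ⟨ν, hν, hdvd⟩ :=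
    exists_prod_X_sub_C_dvd_of_le_sum_rootMultiplicity (pertDet_ne_zero hm A hA Δ) hΔ
  exact (iInf₂_le ν hν).trans
    (iSup_le fun Γ => ENNReal.ofReal_le_ofReal (objective_le_specNorm hn hr A Δ ν Γ hdvd))

theorem objective_nonneg (A : Fin (m + 1) → Matrix (Fin n) (Fin n) ℂ) (μ : Fin r → ℂ)
    (Γ : Params r) : 0 ≤ objective A μ Γ :=
  LinearMap.singularValues_nonneg _ _

theorem tau_le_objective (hm : 0 < m) (hn : 0 < n) (hr : 0 < r)
    (A : Fin (m + 1) → Matrix (Fin n) (Fin n) ℂ) (hA : (A (Fin.last m)).rank = n)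
    (S : Finset ℂ) {μ : Fin r → ℂ} (hμ : μ ∈ tuples S r) {Γ : Params r}
    (hopt : IsOptimalParams A μ Γ) (hmul : MultiplicityAssumption A μ Γ)
    (hlin : LinearIndependenceAssumption A μ Γ) :
    tau A S r ≤ ENNReal.ofReal (objective A μ Γ) := by
  obtain ⟨U, V, -, -, hQV, hUQ, hrank⟩ := hlin
  have hUV : IsSingularPair (blockQ A μ Γ) (objective A μ Γ) U.vec V.vec := ⟨hQV, hUQ⟩
  set σ := objective A μ Γ
  have hσ0 : 0 ≤ σ := objective_nonneg A μ Γ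
  set Δ := -(σ : ℂ) • (U * leftInv V) with hΔ
  have hnorm : specNorm Δ ≤ σ := by
    rw [hΔ, specNorm_smul, norm_neg, Complex.norm_real, Real.norm_of_nonneg hσ0]
    rcases hσ0.eq_or_lt with h0 | h0
    · rw [← h0, zero_mul]
    · exact mul_le_of_le_one_right hσ0 (specNorm_mul_leftInv_le_one hrank
        (conjTranspose_mul_self_eq_of_isOptimalParams hn hr hopt hmul h0 hUV))
  have hinv : ∑ j : Fin (m + 1), A j * V * triC μ Γ ^ (j : ℕ) + Δ * V = 0 := by
    rw [sum_mul_triC_pow_of_isSingularPair hUV, hΔ, Matrix.smul_mul, Matrix.mul_assoc,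
      leftInv_mul hrank, Matrix.mul_one, neg_smul, add_neg_cancel]
  have hdvd := charpoly_dvd_pertDet A Δ (leftInv_mul hrank) hinv
  rw [charpoly_triC] at hdvd
  exact (iInf₂_le Δ (le_sum_rootMultiplicity (pertDet_ne_zero hm A hA Δ) hμ hdvd)).trans
    (ENNReal.ofReal_le_ofReal hnorm)

end Bounds

/-! ### Attainment of the inner supremum -/

theorem continuous_svSmallest {ι : Type*} [Fintype ι] [DecidableEq ι] (k : ℕ) :
    Continuous (svSmallest k : Matrix ι ι ℂ → ℝ) := by
  open scoped Matrix.Norms.L2Operator in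
  refine LipschitzWith.continuous (K := 1) (LipschitzWith.of_le_add fun M N => ?_)
  refine singularValues_le_add _ _ _ dist_nonneg fun x => ?_
  rw [dist_eq_norm, ← LinearMap.sub_apply, ← map_sub]
  exact Matrix.l2_opNorm_mulVec (M - N) x

theorem exists_norm_mulVec_le {ι : Type*} [Fintype ι] {s : Set (Matrix ι ι ℂ)}
    (hs : IsCompact s) :
    ∃ K, 0 ≤ K ∧ ∀ M ∈ s, ∀ x : ι → ℂ, ‖WithLp.toLp 2 (M *ᵥ x)‖ ≤ K * ‖WithLp.toLp 2 x‖ := by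
  classical
  open scoped Matrix.Norms.L2Operator in
  obtain ⟨K, hK, h⟩ := hs.isBounded.exists_pos_norm_le
  exact ⟨K, hK.le, fun M hM x => (Matrix.l2_opNorm_mulVec M (WithLp.toLp 2 x)).trans
    (mul_le_mul_of_nonneg_right (h M hM) (norm_nonneg _))⟩

section Block

variable {κ α : Type*} [Fintype κ] [Fintype α]

theorem norm_toLp_block_le (x : κ × α → ℂ) (l : κ) :
    ‖WithLp.toLp 2 (block x l)‖ ≤ ‖WithLp.toLp 2 x‖ := by
  refine le_of_sq_le_sq ?_ (norm_nonneg _)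
  rw [norm_sq_toLp_eq_sum_block]
  exact Finset.single_le_sum (f := fun l => ‖WithLp.toLp 2 (block x l)‖ ^ 2)
    (fun _ _ => sq_nonneg _) (Finset.mem_univ l)

theorem block_mulVec (M : Matrix (κ × α) (κ × α) ℂ) (x : κ × α → ℂ) (i : κ) :
    block (M *ᵥ x) i = ∑ q, M.submatrix (Prod.mk i) (Prod.mk q) *ᵥ block x q := by
  ext a
  simp only [block, Matrix.mulVec, dotProduct, Fintype.sum_prod_type, Finset.sum_apply,
    Matrix.submatrix_apply]

variable [LinearOrder κ]

/-- The blocks of `x` before `l` together with the blocks of `M x` after `l`. -/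
def blockMap (M : Matrix (κ × α) (κ × α) ℂ) (l : κ) :
    (κ × α → ℂ) →ₗ[ℂ] ({i : κ // i ≠ l} × α → ℂ) :=
  LinearMap.pi fun p =>
    if p.1.1 < l then LinearMap.proj (p.1.1, p.2)
    else LinearMap.proj (p.1.1, p.2) ∘ₗ M.mulVecLin

/-- The vectors that vanish in the blocks before `l` and whose image under `M` vanishes in the
blocks after `l`. -/
def blockSpace (M : Matrix (κ × α) (κ × α) ℂ) (l : κ) : Submodule ℂ (κ × α → ℂ) :=
  LinearMap.ker (blockMap M l)

theorem card_le_finrank_blockSpace (M : Matrix (κ × α) (κ × α) ℂ) (l : κ) :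
    Fintype.card α ≤ finrank ℂ (blockSpace M l) := by
  have hker :
      finrank ℂ (LinearMap.range (blockMap M l)) + finrank ℂ (blockSpace M l) =
      Fintype.card κ * Fintype.card α := by
    rw [← Fintype.card_prod, ← finrank_fintype_fun_eq_card ℂ]
    exact (blockMap M l).finrank_range_add_finrank_ker
  have hrange : finrank ℂ (LinearMap.range (blockMap M l)) ≤
      (Fintype.card κ - 1) * Fintype.card α := by
    rw [← Set.card_ne_eq l, ← Fintype.card_prod, ← finrank_fintype_fun_eq_card ℂ]
    exact Submodule.finrank_le _
  have hpos : 0 < Fintype.card κ := Fintype.card_pos_iff.mpr ⟨l⟩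
  rw [Nat.sub_one_mul] at hrange
  have := Nat.le_mul_of_pos_left (Fintype.card α) hpos
  omega

variable {M : Matrix (κ × α) (κ × α) ℂ} {l : κ} {x : κ × α → ℂ}

theorem block_eq_zero_of_mem_blockSpace (hx : x ∈ blockSpace M l) {q : κ} (hq : q < l) :
    block x q = 0 := by
  ext a
  simpa [block, blockMap, hq] using congrFun (LinearMap.mem_ker.mp hx) (⟨q, hq.ne⟩, a)

theorem block_mulVec_eq_zero_of_mem_blockSpace (hx : x ∈ blockSpace M l) {q : κ} (hq : l < q) :
    block (M *ᵥ x) q = 0 := by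
  ext a
  simpa [block, blockMap, hq.not_gt] using congrFun (LinearMap.mem_ker.mp hx) (⟨q, hq.ne'⟩, a)

theorem norm_toLp_mulVec_of_mem_blockSpace
    (hM : ∀ i q, i < q → M.submatrix (Prod.mk i) (Prod.mk q) = 0) (hx : x ∈ blockSpace M l) :
    ‖WithLp.toLp 2 (M *ᵥ x)‖ =
      ‖WithLp.toLp 2 (M.submatrix (Prod.mk l) (Prod.mk l) *ᵥ block x l)‖ := by
  have hle : ∀ i ≤ l,
      block (M *ᵥ x) i = M.submatrix (Prod.mk i) (Prod.mk l) *ᵥ block x l := by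
    intro i hi
    rw [block_mulVec, Fintype.sum_eq_single l]
    intro q hq
    rcases lt_or_gt_of_ne hq with hql | hlq
    · rw [block_eq_zero_of_mem_blockSpace hx hql, Matrix.mulVec_zero]
    · rw [hM i q (hi.trans_lt hlq), Matrix.zero_mulVec]
  rw [← sq_eq_sq₀ (norm_nonneg _) (norm_nonneg _), norm_sq_toLp_eq_sum_block,
    Fintype.sum_eq_single l, hle l le_rfl]
  intro q hq
  have hzero : block (M *ᵥ x) q = 0 := by
    rcases lt_or_gt_of_ne hq with hql | hlq
    · rw [hle q hql.le, hM q l hql, Matrix.zero_mulVec]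
    · exact block_mulVec_eq_zero_of_mem_blockSpace hx hlq
  simp [hzero]

end Block

section Params

variable {n m r : ℕ}

theorem chainTotal_sub_chainTotal (μ : Fin r → ℂ) {Γ Γ' : Params r} {l i : Fin r}
    (h : ∀ a b, l ≤ a → b ≤ i → (a, b) ≠ (l, i) → gam Γ b a = gam Γ' b a) (p : ℂ[X]) :
    chainTotal μ Γ l i p - chainTotal μ Γ' l i p =
      (gam Γ i l - gam Γ' i l) * divDiff ![μ l, μ i] p := by
  induction p using Polynomial.induction_on' with
  | add p q hp hq =>
    simp only [map_add, mul_add, ← hp, ← hq]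
    ring
  | monomial j c =>
    simp only [← smul_X_eq_monomial, map_smul, smul_eq_mul]
    rw [← mul_sub, mul_left_comm]
    congr 1
    induction j generalizing l with
    | zero => simp [chainTotal_one, divDiff_one_succ]
    | succ j ih =>
      have hsum : ∑ b, gam Γ b l * chainTotal μ Γ b i (X ^ j) -
          ∑ b, gam Γ' b l * chainTotal μ Γ' b i (X ^ j) =
          (gam Γ i l - gam Γ' i l) * (X ^ j : ℂ[X]).eval (μ i) := by
        rw [← Finset.sum_sub_distrib, Fintype.sum_eq_single i]
        · simp only [chainTotal_of_not_lt _ _ (lt_irrefl i), if_true, sub_mul]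
        intro b hb
        by_cases hlb : l < b
        · by_cases hbi : b < i
          · have hshorter := ih (l := b) fun a c hba hci _ => h a c (hlb.le.trans hba) hci
              fun hac => (hlb.trans_le hba).ne' (congrArg Prod.fst hac)
            rw [h b i hlb.le le_rfl fun hac => hlb.ne' (congrArg Prod.fst hac), sub_self,
              zero_mul, sub_eq_zero] at hshorter
            rw [h l b le_rfl hbi.le fun hac => hb (congrArg Prod.snd hac), hshorter, sub_self]
          · simp only [chainTotal_of_not_lt _ _ hbi, if_neg hb, mul_zero, sub_self]
        · simp only [gam_eq_zero _ hlb, zero_mul, sub_self]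
      have hdiv : divDiff ![μ l, μ i] (X * X ^ j) =
          μ l * divDiff ![μ l, μ i] (X ^ j) + (X ^ j : ℂ[X]).eval (μ i) := by
        rw [divDiff_X_mul, divDiff_zero]
        rfl
      rw [pow_succ', chainTotal_X_mul, chainTotal_X_mul, hdiv]
      linear_combination μ l * ih h + hsum

variable (A : Fin (m + 1) → Matrix (Fin n) (Fin n) ℂ) (μ : Fin r → ℂ)

theorem submatrix_blockQ_of_lt (Γ : Params r) {i q : Fin r} (h : i < q) :
    (blockQ A μ Γ).submatrix (Prod.mk i) (Prod.mk q) = 0 := by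
  ext a b
  simp [blockQ, h.not_gt, h.ne]

theorem submatrix_blockQ_self (Γ : Params r) (l : Fin r) :
    (blockQ A μ Γ).submatrix (Prod.mk l) (Prod.mk l) = value A (μ l) := by
  ext a b
  simp [blockQ]

theorem submatrix_blockQ_sub {Γ Γ' : Params r} {l i : Fin r}
    (h : ∀ a b, l ≤ a → b ≤ i → (a, b) ≠ (l, i) → gam Γ b a = gam Γ' b a) :
    (blockQ A μ Γ).submatrix (Prod.mk i) (Prod.mk l) -
        (blockQ A μ Γ').submatrix (Prod.mk i) (Prod.mk l) =
      (gam Γ i l - gam Γ' i l) • matDividedDiff A ![μ l, μ i] := by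
  ext a b
  simp only [Matrix.sub_apply, Matrix.submatrix_apply, Matrix.smul_apply, smul_eq_mul,
    blockQ_apply, matDividedDiff_apply, chainTotal_sub_chainTotal μ h]

theorem block_blockQ_mulVec_sub {Γ Γ' : Params r} {l i : Fin r}
    (h : ∀ a b, l ≤ a → b ≤ i → (a, b) ≠ (l, i) → gam Γ b a = gam Γ' b a)
    {x : Fin r × Fin n → ℂ} (hx : ∀ q < l, block x q = 0) :
    block (blockQ A μ Γ *ᵥ x) i - block (blockQ A μ Γ' *ᵥ x) i =
      (gam Γ i l - gam Γ' i l) • (matDividedDiff A ![μ l, μ i] *ᵥ block x l) := by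
  simp only [block_mulVec, ← Finset.sum_sub_distrib, ← Matrix.sub_mulVec]
  rw [Fintype.sum_eq_single l, submatrix_blockQ_sub A μ h, Matrix.smul_mulVec]
  intro q hq
  rcases lt_or_gt_of_ne hq with hql | hlq
  · rw [hx q hql, Matrix.mulVec_zero]
  · rw [submatrix_blockQ_sub A μ fun a b hqa hbi _ => h a b (hlq.le.trans hqa) hbi
        fun hab => (hlq.trans_le hqa).ne' (congrArg Prod.fst hab),
      h q i hlq.le le_rfl fun hab => hq (congrArg Prod.fst hab), sub_self, zero_smul,
      Matrix.zero_mulVec]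

/-- The parameters `Γ` with the entries `γ_{il}`, `d ≤ i - l`, replaced by `0`.  The subtraction
does not truncate, since `l < i`. -/
def truncate (Γ : Params r) (d : ℕ) : Params r := fun p =>
  if (p.1.1 : ℕ) - (p.1.2 : ℕ) < d then Γ p else 0

theorem truncate_self (Γ : Params r) : truncate Γ r = Γ :=
  funext fun p => if_pos ((Nat.sub_le _ _).trans_lt p.1.1.2)

theorem gam_truncate (Γ : Params r) (d : ℕ) (i l : Fin r) :
    gam (truncate Γ d) i l = if (i : ℕ) - (l : ℕ) < d then gam Γ i l else 0 := by
  simp only [gam, truncate]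
  split_ifs <;> rfl

/-- On vectors of `blockSpace`, row `i` of the block system expresses `γ_{il} P[μ_l, μ_i] x_l`
through shorter chains. -/
theorem norm_gam_mul_norm_block_le {Γ : Params r} {l i : Fin r} (hli : l < i)
    (hG : IsUnit (matDividedDiff A ![μ l, μ i])) {K : ℝ} {x : Fin r × Fin n → ℂ}
    (hK : ‖WithLp.toLp 2 (blockQ A μ (truncate Γ (i - l)) *ᵥ x)‖ ≤ K)
    (hx : x ∈ blockSpace (blockQ A μ Γ) l) :
    ‖gam Γ i l‖ * ‖WithLp.toLp 2 (block x l)‖ ≤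
      specNorm (matDividedDiff A ![μ l, μ i])⁻¹ * K := by
  set G := matDividedDiff A ![μ l, μ i]
  set y := block (blockQ A μ (truncate Γ (i - l)) *ᵥ x) i
  have hrow : -y = gam Γ i l • (G *ᵥ block x l) := by
    have hagree : ∀ a b, l ≤ a → b ≤ i → (a, b) ≠ (l, i) →
        gam Γ b a = gam (truncate Γ (i - l)) b a := by
      intro a b hla hbi hne
      rw [gam_truncate, if_pos]
      rw [Ne, Prod.mk.injEq] at hne
      omega
    have := block_blockQ_mulVec_sub A μ hagree fun q hq => block_eq_zero_of_mem_blockSpace hx hq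
    rwa [gam_truncate, if_neg (lt_irrefl _), sub_zero,
      block_mulVec_eq_zero_of_mem_blockSpace hx hli, zero_sub] at this
  have hsolve : gam Γ i l • block x l = G⁻¹ *ᵥ -y := by
    rw [hrow, Matrix.mulVec_smul, Matrix.mulVec_mulVec,
      Matrix.nonsing_inv_mul _ ((Matrix.isUnit_iff_isUnit_det _).mp hG), Matrix.one_mulVec]
  calc ‖gam Γ i l‖ * ‖WithLp.toLp 2 (block x l)‖ = ‖WithLp.toLp 2 (G⁻¹ *ᵥ -y)‖ := by
        rw [← hsolve, WithLp.toLp_smul, norm_smul]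
    _ ≤ specNorm G⁻¹ * ‖WithLp.toLp 2 (-y)‖ := norm_toLp_mulVec_le _ _
    _ ≤ specNorm G⁻¹ * K := by
        rw [WithLp.toLp_neg, norm_neg]
        exact mul_le_mul_of_nonneg_left ((norm_toLp_block_le _ i).trans hK) (specNorm_nonneg _)

theorem objective_mul_norm_gam_le (hr : 0 < r) (hrn : r ≤ n) {Γ : Params r} {l i : Fin r}
    (hli : l < i) (hG : IsUnit (matDividedDiff A ![μ l, μ i])) {K : ℝ} (hK0 : 0 ≤ K)
    (hK : ∀ x, ‖WithLp.toLp 2 (blockQ A μ (truncate Γ (i - l)) *ᵥ x)‖ ≤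
      K * ‖WithLp.toLp 2 x‖) :
    objective A μ Γ * ‖gam Γ i l‖ ≤
      specNorm (value A (μ l)) * (specNorm (matDividedDiff A ![μ l, μ i])⁻¹ * K) := by
  rcases (norm_nonneg (gam Γ i l)).eq_or_lt with hγ | hγ
  · rw [← hγ, mul_zero]
    have := specNorm_nonneg (value A (μ l))
    have := specNorm_nonneg (matDividedDiff A ![μ l, μ i])⁻¹
    positivity
  rw [← le_div_iff₀ hγ]
  refine svSmallest_le hr ?_ (blockSpace (blockQ A μ Γ) l) ?_ fun x hx => ?_
  · simpa using Nat.le_mul_of_pos_right r (hr.trans_le hrn)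
  · exact hrn.trans ((Fintype.card_fin n).ge.trans (card_le_finrank_blockSpace _ l))
  rw [div_mul_eq_mul_div, le_div_iff₀ hγ,
    norm_toLp_mulVec_of_mem_blockSpace (fun _ _ => submatrix_blockQ_of_lt A μ Γ) hx,
    submatrix_blockQ_self]
  calc ‖WithLp.toLp 2 (value A (μ l) *ᵥ block x l)‖ * ‖gam Γ i l‖
      ≤ specNorm (value A (μ l)) * ‖WithLp.toLp 2 (block x l)‖ * ‖gam Γ i l‖ :=
        mul_le_mul_of_nonneg_right (norm_toLp_mulVec_le _ _) hγ.le
    _ = specNorm (value A (μ l)) * (‖gam Γ i l‖ * ‖WithLp.toLp 2 (block x l)‖) := by ring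
    _ ≤ specNorm (value A (μ l)) *
        (specNorm (matDividedDiff A ![μ l, μ i])⁻¹ * (K * ‖WithLp.toLp 2 x‖)) :=
        mul_le_mul_of_nonneg_left (norm_gam_mul_norm_block_le A μ hli hG (hK x) hx)
          (specNorm_nonneg _)
    _ = _ := by ring

theorem continuous_objective : Continuous (objective A μ) :=
  (continuous_svSmallest r).comp (continuous_blockQ A μ)

theorem exists_norm_truncate_le (hr : 0 < r) (hrn : r ≤ n)
    (hG : ∀ k l : Fin r, k < l → IsUnit (matDividedDiff A ![μ k, μ l])) {ε : ℝ} (hε : 0 < ε)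
    (d : ℕ) : ∃ R, ∀ Γ : Params r, ε ≤ objective A μ Γ → ‖truncate Γ d‖ ≤ R := by
  induction d with
  | zero => exact ⟨0, fun Γ _ => (pi_norm_le_iff_of_nonneg le_rfl).mpr fun p => by simp [truncate]⟩
  | succ d ih =>
    obtain ⟨R, hR⟩ := ih
    obtain ⟨K, hK0, hK⟩ := exists_norm_mulVec_le
      ((isCompact_closedBall (0 : Params r) R).image (continuous_blockQ A μ))
    obtain ⟨B, hB⟩ := (Set.finite_range fun p : Fin r × Fin r => specNorm (value A (μ p.2)) *
      (specNorm (matDividedDiff A ![μ p.2, μ p.1])⁻¹ * K) / ε).bddAbove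
    refine ⟨max R B, fun Γ hΓ => ?_⟩
    have hR0 : 0 ≤ R := (norm_nonneg _).trans (hR Γ hΓ)
    refine (pi_norm_le_iff_of_nonneg (hR0.trans (le_max_left R B))).mpr ?_
    rintro ⟨⟨i, l⟩, hli⟩
    rcases lt_trichotomy ((i : ℕ) - (l : ℕ)) d with hlt | rfl | hgt
    · refine le_max_of_le_left (le_trans ?_ (hR Γ hΓ))
      simpa only [truncate, if_pos hlt, if_pos (hlt.trans d.lt_succ_self)] using
        norm_le_pi_norm (truncate Γ d) ⟨(i, l), hli⟩
    · have hgam := objective_mul_norm_gam_le A μ hr hrn hli (hG l i hli) hK0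
        (hK _ (Set.mem_image_of_mem _ (mem_closedBall_zero_iff.mpr (hR Γ hΓ))))
      rw [gam, dif_pos (show l < i from hli)] at hgam
      simp only [truncate, if_pos (Nat.lt_succ_self _)]
      refine le_max_of_le_right (le_trans ?_ (hB (Set.mem_range_self (i, l))))
      rw [le_div_iff₀ hε, mul_comm]
      exact (mul_le_mul_of_nonneg_right hΓ (norm_nonneg _)).trans hgam
    · simp only [truncate, if_neg (show ¬ (i : ℕ) - (l : ℕ) < d + 1 by omega), norm_zero]
      exact le_max_of_le_left hR0

theorem exists_isOptimalParams (hr : 0 < r) (hrn : r ≤ n)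
    (hG : ∀ k l : Fin r, k < l → IsUnit (matDividedDiff A ![μ k, μ l])) :
    ∃ Γ, IsOptimalParams A μ Γ := by
  by_cases hzero : ∀ Γ, objective A μ Γ ≤ 0
  · exact ⟨0, fun Γ => (hzero Γ).trans (objective_nonneg A μ 0)⟩
  push Not at hzero
  obtain ⟨Γ₀, hΓ₀⟩ := hzero
  obtain ⟨R, hR⟩ := exists_norm_truncate_le A μ hr hrn hG hΓ₀ r
  simp only [truncate_self] at hR
  refine (continuous_objective A μ).exists_forall_ge' Γ₀ ?_
  filter_upwards [(tendsto_norm_cocompact_atTop (E := Params r)).eventually_gt_atTop R] with Γ hΓ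
  exact (not_le.mp (mt (hR Γ) hΓ.not_ge)).le

variable {A μ}

theorem innerSup_eq_of_isOptimalParams {Γ : Params r} (h : IsOptimalParams A μ Γ) :
    innerSup A μ = ENNReal.ofReal (objective A μ Γ) :=
  le_antisymm (iSup_le fun Γ' => ENNReal.ofReal_le_ofReal (h Γ'))
    (le_iSup (fun Γ' => ENNReal.ofReal (objective A μ Γ')) Γ)

end Params

end MatPoly

end

theorem theorem3p3 {n m r : ℕ} (hm : 0 < m) (hr : 0 < r)
    (A : Fin (m + 1) → Matrix (Fin n) (Fin n) ℂ) (hA : (A (Fin.last m)).rank = n)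
    (S : Finset ℂ) :
    (∀ (μ : Fin r → ℂ) (Γ : MatPoly.Params r), MatPoly.kronQ A μ Γ = MatPoly.blockQ A μ Γ) ∧
    ∀ μ : Fin r → ℂ, MatPoly.IsOptimalNodes A S μ →
      ((n < r ∨ ∃ k l : Fin r, k < l ∧ (MatPoly.matDividedDiff A ![μ k, μ l]).rank < n) →
        ∃ Γ, MatPoly.IsOptimalParams A μ Γ) →
      ((∃ Γ, MatPoly.IsOptimalParams A μ Γ) →
        ∃ Γ, MatPoly.IsOptimalParams A μ Γ ∧ MatPoly.MultiplicityAssumption A μ Γ ∧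
          MatPoly.LinearIndependenceAssumption A μ Γ) →
      MatPoly.tau A S r =
        ⨅ ν ∈ MatPoly.tuples S r, ⨆ Γ : MatPoly.Params r,
          ENNReal.ofReal (MatPoly.svSmallest r (MatPoly.blockQ A ν Γ)) := by
  refine ⟨MatPoly.kronQ_eq_blockQ A, fun μ hμ hatt hgood => ?_⟩
  have hex : ∃ Γ, MatPoly.IsOptimalParams A μ Γ := by
    by_cases hdeg : n < r ∨ ∃ k l : Fin r, k < l ∧ (MatPoly.matDividedDiff A ![μ k, μ l]).rank < n
    · exact hatt hdeg
    push Not at hdeg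
    refine MatPoly.exists_isOptimalParams A μ hr hdeg.1 fun k l hkl => ?_
    refine MatPoly.isUnit_of_rank_eq_card (le_antisymm (Matrix.rank_le_card_width _) ?_)
    exact (Fintype.card_fin n).le.trans (hdeg.2 k l hkl)
  obtain ⟨Γ, hopt, hmul, hlin⟩ := hgood hex
  have hrn : r ≤ n := by
    obtain ⟨U, V, -, -, -, -, hV⟩ := hlin
    exact hV.ge.trans (V.rank_le_card_height.trans (Fintype.card_fin n).le)
  have hn : 0 < n := hr.trans_le hrn
  refine le_antisymm ?_ (MatPoly.iInf_innerSup_le_tau hm hn hr A hA S)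
  refine (MatPoly.tau_le_objective hm hn hr A hA S hμ.1 hopt hmul hlin).trans ?_
  rw [← MatPoly.innerSup_eq_of_isOptimalParams hopt]
  exact le_iInf₂ hμ.2
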